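/- Let $(T,\mathcal T)$ be a measurable space with a probability measure $\mu$, and let $\tau\mapsto\Lambda_\tau$ be a measurable map assigning to each $\tau\in T$ a Borel probability measure $\Lambda_\tau$ on $\mathbb R$ all of whose moments exist, i.e. $\int |x|^k\,d\Lambda_\tau(x)<\infty$ for all $k\in\mathbb N$. Put $$\mathbb P^{\mu,\Lambda}:=\int_T P_\tau\,d\mu(\tau),\qquad P_\tau:=\bigotimes_{i=1}^{\infty}\Lambda_\tau ,$$ the law on $\mathbb R^{\mathbb N}$ of an exchangeable sequence $(\xi_i)_i$. For each $N$ let $X_N$ be the real symmetric $N\times N$ matrix whose entries $X_N(i,j)$, $1\le i\le j\le N$, are $N(N+1)/2$ distinct members of the sequence $(\xi_i)_i$, in an arbitrary order (for instance the first $N(N+1)/2$ members). Let $$\sigma_N=\frac1N\sum_{j=1}^N\delta_{\lambda_j(X_N/\sqrt N)}$$ be the eigenvalue distribution measure of $X_N/\sqrt N$, where the eigenvalues $\lambda_j$ are counted with multiplicity. For $v>0$ let $\sigma_v$ be the semicircle distribution, i.e. the measure on $\mathbb R$ with Lebesgue density $\frac{1}{2\pi v}\sqrt{4v-x^2}$ for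 $|x|\le 2\sqrt v$ and $0$ otherwise, and let $\sigma_0=\delta_0$. Let $v(\tau)$ be the variance of $\Lambda_\tau$ and $$\sigma_\mu:=\int_T\sigma_{v(\tau)}\,d\mu(\tau).$$ Then $\sigma_\mu$ is a probability measure, and $\sigma_N$ converges weakly in expectation to $\sigma_\mu$ with respect to $\mathbb P^{\mu,\Lambda}$: for every bounded continuous $f:\mathbb R\to\mathbb R$, the random variables $\int f\,d\sigma_N$ are integrable and $$\mathbb E^{\mu,\Lambda}\Big(\int f\,d\sigma_N\Big)\longrightarrow\int f\,d\sigma_\mu\qquad(N\to\infty).$$ -/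

import Mathlib

open MeasureTheory ProbabilityTheory Filter Topology
open scoped ENNReal BoundedContinuousFunction

noncomputable section

namespace ExchangeableEnsemble

/-- All moments of the Borel measure `ν` on `ℝ` exist: `∫ |x|^k dν(x) < ∞` for all `k`. -/
def AllMomentsExist (ν : Measure ℝ) : Prop :=
  ∀ k : ℕ, Integrable (fun x : ℝ => |x| ^ k) ν

/-- The law `P = ⨂_{i=1}^∞ ν` on `ℝ^ℕ` of a sequence of i.i.d. random variables with
distribution `ν`. -/
def iidLaw (ν : Measure ℝ) : Measure (ℕ → ℝ) :=
  Measure.infinitePi (fun _ : ℕ => ν)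

/-- The density of the semicircle distribution with variance `v > 0`, that is
`√(4 v - x²) / (2 π v)` for `|x| ≤ 2 √v` and `0` otherwise
(for `|x| > 2 √v` the real square root of the negative number `4 v - x²` is `0` in Lean). -/
def semicircleDensity (v x : ℝ) : ℝ :=
  √(4 * v - x ^ 2) / (2 * Real.pi * v)

/-- The semicircle distribution `σ_v` with support `[-2 √v, 2 √v]`; for `v = 0` the support is
`{0}` and `σ_0` is the Dirac measure at `0`. -/
def semicircle (v : ℝ) : Measure ℝ :=
  if v = 0 then Measure.dirac 0
  else volume.withDensity (fun x => ENNReal.ofReal (semicircleDensity v x))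

section Mixtures

variable {T : Type*} [MeasurableSpace T]

/-- The variance `v(τ)` of the distribution `Λ_τ`. -/
def entryVariance (Λ : Kernel T ℝ) (τ : T) : ℝ :=
  variance (fun x : ℝ => x) (Λ τ)

/-- The law `ℙ^{μ,Λ} = ∫_T P_τ dμ(τ)` with `P_τ = ⨂_{i=1}^∞ Λ_τ`: the `μ`-average of the laws of
i.i.d. sequences with distribution `Λ_τ`. -/
def exchangeableLaw (μ : Measure T) (Λ : Kernel T ℝ) : Measure (ℕ → ℝ) :=
  μ.bind (fun τ => iidLaw (Λ τ))

/-- The mixture of semicircles `σ_μ = ∫_T σ_{v(τ)} dμ(τ)`. -/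
def semicircleMixture (μ : Measure T) (Λ : Kernel T ℝ) : Measure ℝ :=
  μ.bind (fun τ => semicircle (entryVariance Λ τ))

/-! The following facts show that the two mixtures are genuine averages of measures. -/

theorem measurable_iidLaw (Λ : Kernel T ℝ) [IsMarkovKernel Λ] :
    Measurable (fun τ => iidLaw (Λ τ)) := by
  have hprob : ∀ τ, IsProbabilityMeasure (iidLaw (Λ τ)) := fun τ => by
    unfold iidLaw; infer_instance
  refine Measurable.measure_of_isPiSystem_of_isProbabilityMeasure
    (generateFrom_squareCylinders (α := fun _ : ℕ => ℝ)).symm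
    (isPiSystem_squareCylinders (fun _ => MeasurableSpace.isPiSystem_measurableSet)
      (fun _ => by simp)) ?_
  rintro _ ⟨s, t, ht, rfl⟩
  have ht' : ∀ i, MeasurableSet (t i) := fun i => ht i (Set.mem_univ i)
  have : (fun τ => iidLaw (Λ τ) ((s : Set ℕ).pi t)) = fun τ => ∏ i ∈ s, Λ τ (t i) := by
    funext τ
    exact Measure.infinitePi_pi (μ := fun _ : ℕ => Λ τ) (fun i _ => ht' i)
  rw [this]
  exact Finset.measurable_prod _ (fun i _ => Λ.measurable_coe (ht' i))

theorem measurable_entryVariance (Λ : Kernel T ℝ) [IsMarkovKernel Λ] :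
    Measurable (entryVariance Λ) := by
  have hm : Measurable (fun τ => ∫ x, x ∂(Λ τ)) :=
    (stronglyMeasurable_id.integral_kernel (κ := Λ)).measurable
  unfold entryVariance variance evariance
  refine Measurable.ennreal_toReal ?_
  refine Measurable.lintegral_kernel_prod_right (κ := Λ)
    (f := fun τ x => ‖x - ∫ y, y ∂(Λ τ)‖ₑ ^ 2) ?_
  exact ((measurable_snd.sub (hm.comp measurable_fst)).enorm).pow_const 2

theorem measurable_semicircle : Measurable semicircle := by
  refine Measure.measurable_of_measurable_coe _ (fun A hA => ?_)
  have h : (fun v => semicircle v A) = fun v => if v = 0 then Measure.dirac (0 : ℝ) A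
      else ∫⁻ x in A, ENNReal.ofReal (semicircleDensity v x) := by
    funext v
    unfold semicircle
    split_ifs
    · rfl
    · exact withDensity_apply _ hA
  rw [h]
  refine Measurable.ite (measurableSet_singleton 0) measurable_const ?_
  refine Measurable.lintegral_prod_right
    (f := fun v x => ENNReal.ofReal (semicircleDensity v x)) ?_
  refine ENNReal.measurable_ofReal.comp ?_
  unfold semicircleDensity
  fun_prop

theorem exchangeableLaw_apply (μ : Measure T) (Λ : Kernel T ℝ) [IsMarkovKernel Λ]
    {A : Set (ℕ → ℝ)} (hA : MeasurableSet A) :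
    exchangeableLaw μ Λ A = ∫⁻ τ, iidLaw (Λ τ) A ∂μ :=
  Measure.bind_apply hA (measurable_iidLaw Λ).aemeasurable

theorem semicircleMixture_apply (μ : Measure T) (Λ : Kernel T ℝ) [IsMarkovKernel Λ]
    {A : Set ℝ} (hA : MeasurableSet A) :
    semicircleMixture μ Λ A = ∫⁻ τ, semicircle (entryVariance Λ τ) A ∂μ :=
  Measure.bind_apply hA (measurable_semicircle.comp (measurable_entryVariance Λ)).aemeasurable

end Mixtures

/-- The eigenvalue distribution measure `(1/N) ∑_j δ_{λ_j(M)}` of a real symmetric `N × N` matrix,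
where the eigenvalues are repeated according to their multiplicity. -/
def eigenvalueDistribution {N : ℕ} (M : Matrix (Fin N) (Fin N) ℝ) (hM : M.IsHermitian) :
    Measure ℝ :=
  (N : ℝ≥0∞)⁻¹ • ∑ j : Fin N, Measure.dirac (hM.eigenvalues j)

/-- The real symmetric matrix `X_N` whose entries on and above the diagonal are distinct members of
the sequence `ξ`. The injection `e` says which member fills which position; a position `(i, j)` with
`i ≤ j` is the same as an unordered pair `s(i, j)`, and there are `N (N + 1) / 2` of them. -/
def ensembleMatrix {N : ℕ} (e : Sym2 (Fin N) ↪ ℕ) (ξ : ℕ → ℝ) : Matrix (Fin N) (Fin N) ℝ :=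
  Matrix.of fun i j => ξ (e s(i, j))

/-- The normalized matrix `X_N / √N`. -/
def normalizedMatrix {N : ℕ} (e : Sym2 (Fin N) ↪ ℕ) (ξ : ℕ → ℝ) : Matrix (Fin N) (Fin N) ℝ :=
  (√(N : ℝ))⁻¹ • ensembleMatrix e ξ

theorem normalizedMatrix_isHermitian {N : ℕ} (e : Sym2 (Fin N) ↪ ℕ) (ξ : ℕ → ℝ) :
    (normalizedMatrix e ξ).IsHermitian := by
  refine Matrix.IsHermitian.ext (fun i j => ?_)
  simp [normalizedMatrix, ensembleMatrix, Sym2.eq_swap]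

/-- The (random) eigenvalue distribution measure `σ_N` of `X_N / √N`. -/
def spectralMeasure {N : ℕ} (e : Sym2 (Fin N) ↪ ℕ) (ξ : ℕ → ℝ) : Measure ℝ :=
  eigenvalueDistribution (normalizedMatrix e ξ) (normalizedMatrix_isHermitian e ξ)

/-- The random measures `ν_N^ω` converge to `ν^ω` weakly in expectation with respect to `P`: for
every bounded continuous `f`, the expectations of `∫ f dν_N^ω` and of `∫ f dν^ω` exist, and the
former converge to the latter. -/
def ConvergesWeaklyInExpectation {Ω : Type*} [MeasurableSpace Ω] (P : Measure Ω)
    (νN : ℕ → Ω → Measure ℝ) (ν : Ω → Measure ℝ) : Prop :=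
  ∀ f : ℝ →ᵇ ℝ,
    (∀ N, Integrable (fun ω => ∫ x, f x ∂(νN N ω)) P) ∧
    Integrable (fun ω => ∫ x, f x ∂(ν ω)) P ∧
    Tendsto (fun N => ∫ ω, (∫ x, f x ∂(νN N ω)) ∂P) atTop (𝓝 (∫ ω, (∫ x, f x ∂(ν ω)) ∂P))

end ExchangeableEnsemble

end

/-! Given `τ`, the entries are i.i.d. with law `Λ τ`, so it suffices to prove the semicircle law in
expectation for a fixed entry law `ν` of mean `M` and variance `v`. The mixture then follows by
dominated convergence in `τ`, since all integrals are bounded by `‖f‖`.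

For i.i.d. entries, let `G = (X_N/√N - z)⁻¹` with `Im z > 0` and let `s` be its normalized trace.
Taking the trace of `(H - z) G = 1` gives `1 + z s = N^(-3/2) ∑ ξ_ij G_ji`. The mean part `M ∑ G_ij`
is a quadratic form in the all-ones vector, hence only `O(N)`, and disappears in the limit. For the
centred part, a cumulant expansion replaces `ξ_ij - M` by `v` times the derivative of `G_ji` in that
entry. Summed over the entries these derivatives give `-v s²` up to `O(1/N)`. Finally `𝔼 s²` is
close to `(𝔼 s)²`, because changing one of the at most `N²` entries moves `s` by `O(N^(-3/2))` per
unit. So `m = 𝔼 s` satisfies `1 + z m + v m² = O(N^(-1/2))` (`norm_self_consistent_le`).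

The Stieltjes transform of `σ_v` solves this equation exactly (`stieltjes_semicircle`), and the
equation is stable among numbers with nonnegative imaginary part (`norm_sub_le_of_quadratic`). Hence
the Stieltjes transforms of the averaged spectral measures converge. This implies weak convergence
(`tendsto_of_tendsto_stieltjes`): values on the imaginary axis control tails, and the functions `x ↦
(x - z)⁻¹` generate a point-separating star algebra. -/

open MeasureTheory ProbabilityTheory Filter Topology
open scoped ENNReal BoundedContinuousFunction

noncomputable section

namespace ExchangeableEnsemble

/-! ### Resampling a coordinate of an i.i.d. family -/

section Resampling

variable {ι X : Type*} [DecidableEq ι] [MeasurableSpace X]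

theorem measurable_update_prod (k : ι) :
    Measurable (fun p : (ι → X) × X => Function.update p.1 k p.2) := by
  refine measurable_pi_iff.2 fun i => ?_
  by_cases h : i = k
  · subst h; simpa using measurable_snd
  · simp only [Function.update_of_ne h]; fun_prop

/-- Resampling one coordinate preserves the law of an i.i.d. family. -/
theorem measurePreserving_update (ν : Measure X) [IsProbabilityMeasure ν] (k : ι) :
    MeasurePreserving (fun p : (ι → X) × X => Function.update p.1 k p.2)
      ((Measure.infinitePi fun _ : ι => ν).prod ν) (Measure.infinitePi fun _ : ι => ν) := by
  refine ⟨measurable_update_prod k, Measure.eq_infinitePi _ fun s t ht => ?_⟩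
  rw [Measure.map_apply (measurable_update_prod k)
    (MeasurableSet.pi s.countable_toSet fun i _ => ht i)]
  by_cases hk : k ∈ s
  · have : (fun p : (ι → X) × X => Function.update p.1 k p.2) ⁻¹' (s : Set ι).pi t
        = ((s.erase k : Finset ι) : Set ι).pi t ×ˢ t k := by
      ext p
      simp only [Set.mem_preimage, Set.mem_pi, Finset.mem_coe, Set.mem_prod, Finset.mem_erase]
      constructor
      · intro h
        exact ⟨fun i hi => by simpa [Function.update_of_ne hi.1] using h i hi.2,
          by simpa using h k hk⟩
      · rintro ⟨h, h'⟩ i hi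
        by_cases hik : i = k
        · subst hik; simpa using h'
        · simpa [Function.update_of_ne hik] using h i ⟨hik, hi⟩
    rw [this, Measure.prod_prod, Measure.infinitePi_pi _ (fun i _ => ht i), mul_comm,
      Finset.mul_prod_erase s (fun i => ν (t i)) hk]
  · have : (fun p : (ι → X) × X => Function.update p.1 k p.2) ⁻¹' (s : Set ι).pi t
        = (s : Set ι).pi t ×ˢ Set.univ := by
      ext p
      simp only [Set.mem_preimage, Set.mem_pi, Finset.mem_coe, Set.mem_prod, Set.mem_univ,
        and_true]
      refine forall₂_congr fun i hi => ?_
      rw [Function.update_of_ne (ne_of_mem_of_not_mem hi hk)]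
    rw [this, Measure.prod_prod, Measure.infinitePi_pi _ (fun i _ => ht i), measure_univ, mul_one]

variable {E : Type*} [NormedAddCommGroup E] [NormedSpace ℝ E]

theorem integral_update (ν : Measure X) [IsProbabilityMeasure ν] (k : ι) {F : (ι → X) → E}
    (hF : Integrable F (Measure.infinitePi fun _ : ι => ν)) :
    ∫ x, ∫ a, F (Function.update x k a) ∂ν ∂(Measure.infinitePi fun _ : ι => ν)
      = ∫ x, F x ∂(Measure.infinitePi fun _ : ι => ν) := by
  have hmp := measurePreserving_update ν k
  have hint := hmp.integrable_comp_of_integrable hF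
  rw [← integral_prod (fun p : (ι → X) × X => F (Function.update p.1 k p.2)) hint]
  conv_rhs => rw [← hmp.map_eq]
  rw [integral_map hmp.measurable.aemeasurable]
  rw [hmp.map_eq]; exact hF.aestronglyMeasurable

theorem integrable_integral_update (ν : Measure X) [IsProbabilityMeasure ν] (k : ι)
    {F : (ι → X) → E} (hF : Integrable F (Measure.infinitePi fun _ : ι => ν)) :
    Integrable (fun x => ∫ a, F (Function.update x k a) ∂ν)
      (Measure.infinitePi fun _ : ι => ν) :=
  ((measurePreserving_update ν k).integrable_comp_of_integrable hF).integral_prod_left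

end Resampling

/-! ### Cumulant expansion to first order -/

section OneVariable

variable {ν : Measure ℝ} [IsProbabilityMeasure ν]

theorem AllMomentsExist.integrable_sub_pow (h : AllMomentsExist ν) (c : ℝ) (k : ℕ) :
    Integrable (fun x => |x - c| ^ k) ν := by
  have h1 : Integrable (fun x => 2 ^ (k - 1) * (|x| ^ k + |c| ^ k)) ν :=
    ((h k).add (integrable_const _)).const_mul _
  refine h1.mono' (by fun_prop) (ae_of_all _ fun x => ?_)
  rw [Real.norm_of_nonneg (by positivity)]
  calc |x - c| ^ k ≤ (|x| + |c|) ^ k := by gcongr; exact abs_sub _ _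
    _ ≤ _ := add_pow_le (abs_nonneg _) (abs_nonneg _) k

theorem AllMomentsExist.integrable_sub (h : AllMomentsExist ν) (c : ℝ) :
    Integrable (fun x => x - c) ν := by
  have := h.integrable_sub_pow c 1
  simp only [pow_one] at this
  exact (integrable_norm_iff (by fun_prop)).1 this

theorem AllMomentsExist.integrable_sub_sq (h : AllMomentsExist ν) (c : ℝ) :
    Integrable (fun x => (x - c) ^ 2) ν := by
  simpa using h.integrable_sub_pow c 2

theorem AllMomentsExist.integrable_id (h : AllMomentsExist ν) : Integrable (fun x => x) ν := by
  simpa using h.integrable_sub 0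

/-- A first-order form of the cumulant expansion `𝔼[(x - 𝔼x) f(x)] ≈ Var(x) 𝔼[f'(x)]`. -/
theorem norm_integral_sub_mean_mul_sub_variance_mul_le (h : AllMomentsExist ν)
    {f f' : ℝ → ℂ} {K B : ℝ} (hf : Measurable f) (hf' : Measurable f')
    (hB : ∀ a, ‖f a‖ ≤ B) (hB' : ∀ a, ‖f' a‖ ≤ B)
    (hK : ∀ a b, ‖f b - f a - (b - a) * f' a‖ ≤ K * |b - a| ^ 2)
    (hK' : ∀ a b, ‖f' b - f' a‖ ≤ K * |b - a|) :
    ‖∫ a, ((a - ∫ x, x ∂ν : ℝ) : ℂ) * f a ∂ν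
        - (variance (fun x => x) ν : ℝ) * ∫ a, f' a ∂ν‖
      ≤ K * (∫ a, |a - ∫ x, x ∂ν| ^ 3 ∂ν
        + variance (fun x => x) ν * ∫ a, |a - ∫ x, x ∂ν| ∂ν) := by
  set m := ∫ x, x ∂ν with hm
  set v := variance (fun x => x) ν with hv
  have hv' : v = ∫ a, (a - m) ^ 2 ∂ν := variance_eq_integral (by fun_prop)
  have hv0 : 0 ≤ v := variance_nonneg _ _
  have i1 := h.integrable_sub m
  have i2 := h.integrable_sub_sq m
  have i1' : Integrable (fun a => ((a - m : ℝ) : ℂ)) ν := i1.ofReal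
  have i2' : Integrable (fun a => (((a - m) ^ 2 : ℝ) : ℂ)) ν := i2.ofReal
  have if' : Integrable f' ν := .of_bound hf'.aestronglyMeasurable B (ae_of_all _ hB')
  have iaf : Integrable (fun a => ((a - m : ℝ) : ℂ) * f a) ν :=
    i1'.mul_bdd hf.aestronglyMeasurable (ae_of_all _ hB)
  have h0 : ∫ a, ((a - m : ℝ) : ℂ) ∂ν = 0 := by
    rw [integral_complex_ofReal, integral_sub h.integrable_id (integrable_const _)]; simp [hm]
  have h2 : ∫ a, (((a - m) ^ 2 : ℝ) : ℂ) ∂ν = v := by rw [integral_complex_ofReal, hv']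
  -- Taylor expansion of `f` at the mean: the constant term vanishes because `a - m` is centred, and
  -- the linear term produces `v * f' m`. Below, `key2` measures the cost of replacing `f' m` by the
  -- average of `f'`.
  have key1 : ∫ a, ((a - m : ℝ) : ℂ) * (f a - f m - (a - m) * f' m) ∂ν
      = ∫ a, ((a - m : ℝ) : ℂ) * f a ∂ν - v * f' m := by
    have : (fun a : ℝ => ((a - m : ℝ) : ℂ) * (f a - f m - (a - m) * f' m))
        = fun a => ((a - m : ℝ) : ℂ) * f a - ((a - m : ℝ) : ℂ) * f m
          - (((a - m) ^ 2 : ℝ) : ℂ) * f' m := by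
      funext a; push_cast; ring
    have i3 : Integrable (fun a => ((a - m : ℝ) : ℂ) * f a - ((a - m : ℝ) : ℂ) * f m) ν :=
      iaf.sub (i1'.mul_const _)
    rw [this, integral_sub i3 (i2'.mul_const _),
      integral_sub iaf (i1'.mul_const _), integral_mul_const, integral_mul_const, h0, h2]
    simp
  have key2 : ∫ a, (f' a - f' m) ∂ν = ∫ a, f' a ∂ν - f' m := by
    rw [integral_sub if' (integrable_const _)]; simp
  have : ∫ a, ((a - m : ℝ) : ℂ) * f a ∂ν - v * ∫ a, f' a ∂ν
      = ∫ a, ((a - m : ℝ) : ℂ) * (f a - f m - (a - m) * f' m) ∂ν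
        - v * ∫ a, (f' a - f' m) ∂ν := by
    rw [key1, key2]; ring
  rw [this]
  refine (norm_sub_le _ _).trans ?_
  rw [mul_add, norm_mul, Complex.norm_real, Real.norm_of_nonneg hv0, ← mul_assoc, mul_comm K v,
    mul_assoc, ← integral_const_mul, ← integral_const_mul]
  refine add_le_add ?_ (mul_le_mul_of_nonneg_left ?_ hv0)
  · refine norm_integral_le_of_norm_le ((h.integrable_sub_pow m 3).const_mul K)
      (ae_of_all _ fun a => ?_)
    rw [norm_mul, Complex.norm_real, Real.norm_eq_abs]
    calc |a - m| * ‖f a - f m - (a - m) * f' m‖ ≤ |a - m| * (K * |a - m| ^ 2) := by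
          gcongr; exact hK m a
      _ = _ := by ring
  · exact norm_integral_le_of_norm_le
      (by simpa using (h.integrable_sub_pow m 1).const_mul K) (ae_of_all _ fun a => hK' m a)

end OneVariable

theorem integrable_eval_infinitePi {ι : Type*} {ν : Measure ℝ} [IsProbabilityMeasure ν]
    (h : AllMomentsExist ν) (k : ι) (c : ℝ) :
    Integrable (fun x : ι → ℝ => x k - c) (Measure.infinitePi fun _ : ι => ν) :=
  (measurePreserving_eval_infinitePi (fun _ : ι => ν) k).integrable_comp_of_integrable
    (h.integrable_sub c)

section Coordinates

variable {ι : Type*} [DecidableEq ι] {ν : Measure ℝ} [IsProbabilityMeasure ν]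

/-- After coordinate `k` is resampled, the inner integral is the one-variable situation with the
other coordinates frozen. Its bound does not depend on them. -/
theorem norm_integral_eval_sub_mean_mul_sub_variance_mul_le (h : AllMomentsExist ν) (k : ι)
    {F F' : (ι → ℝ) → ℂ} {K B : ℝ} (hF : Measurable F) (hF' : Measurable F')
    (hB : ∀ x, ‖F x‖ ≤ B) (hB' : ∀ x, ‖F' x‖ ≤ B)
    (hK : ∀ x b, ‖F (Function.update x k b) - F x - (b - x k) * F' x‖ ≤ K * |b - x k| ^ 2)
    (hK' : ∀ x b, ‖F' (Function.update x k b) - F' x‖ ≤ K * |b - x k|) :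
    ‖∫ x, ((x k - ∫ y, y ∂ν : ℝ) : ℂ) * F x ∂(Measure.infinitePi fun _ : ι => ν)
        - (variance (fun y => y) ν : ℝ) * ∫ x, F' x ∂(Measure.infinitePi fun _ : ι => ν)‖
      ≤ K * (∫ a, |a - ∫ y, y ∂ν| ^ 3 ∂ν
        + variance (fun y => y) ν * ∫ a, |a - ∫ y, y ∂ν| ∂ν) := by
  set P := Measure.infinitePi fun _ : ι => ν
  set m := ∫ y, y ∂ν with hm
  set v := variance (fun y => y) ν with hv
  have iF' : Integrable F' P := .of_bound hF'.aestronglyMeasurable B (ae_of_all _ hB')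
  have iF : Integrable (fun x => ((x k - m : ℝ) : ℂ) * F x) P :=
    (integrable_eval_infinitePi h k m).ofReal.mul_bdd hF.aestronglyMeasurable (ae_of_all _ hB)
  rw [← integral_update ν k iF, ← integral_update ν k iF', ← integral_const_mul,
    ← integral_sub (integrable_integral_update ν k iF)
      ((integrable_integral_update ν k iF').const_mul _)]
  refine (norm_integral_le_of_norm_le_const (C := K * (∫ a, |a - m| ^ 3 ∂ν
    + v * ∫ a, |a - m| ∂ν)) (ae_of_all _ fun x => ?_)).trans (by simp)
  have hu : Measurable fun a => Function.update x k a := measurable_update x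
  simp only [Function.update_self]
  refine norm_integral_sub_mean_mul_sub_variance_mul_le h (hF.comp hu) (hF'.comp hu)
    (fun _ => hB _) (fun _ => hB' _) (fun a b => ?_) (fun a b => ?_)
  · simpa using hK (Function.update x k a) b
  · simpa using hK' (Function.update x k a) b

end Coordinates

/-! ### Fluctuations of functions of independent variables -/

section Concentration

variable {ν : Measure ℝ} [IsProbabilityMeasure ν]

/-- Subtracting the constant `f m` does not change the left side, and then each of the two terms is
at most `c ^ 2 * v`. The squares carry no modulus because the quadratic equation for the resolvent
trace needs the holomorphic square. The factor `4` leaves room to spare. -/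
theorem norm_integral_sq_sub_sq_integral_le (h : AllMomentsExist ν) {f : ℝ → ℂ} {B c : ℝ}
    (hf : Measurable f) (hB : ∀ a, ‖f a‖ ≤ B) (hc : ∀ a b, ‖f b - f a‖ ≤ c * |b - a|) :
    ‖∫ a, f a ^ 2 ∂ν - (∫ a, f a ∂ν) ^ 2‖ ≤ 4 * c ^ 2 * variance (fun x => x) ν := by
  set m := ∫ x, x ∂ν
  set v := variance (fun x => x) ν with hv
  have hv' : v = ∫ a, (a - m) ^ 2 ∂ν := variance_eq_integral (by fun_prop)
  have i2 := h.integrable_sub_sq m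
  have i1 := h.integrable_sub_pow m 1
  simp only [pow_one] at i1
  have iff : Integrable f ν := .of_bound hf.aestronglyMeasurable B (ae_of_all _ hB)
  have iff2 : Integrable (fun a => f a ^ 2) ν :=
    .of_bound (hf.pow_const 2).aestronglyMeasurable (B ^ 2) (ae_of_all _ fun a => by
      rw [norm_pow]; gcongr; exact hB a)
  have e : ∫ a, f a ^ 2 ∂ν - (∫ a, f a ∂ν) ^ 2
      = ∫ a, (f a - f m) ^ 2 ∂ν - (∫ a, (f a - f m) ∂ν) ^ 2 := by
    have : (fun a => (f a - f m) ^ 2) = fun a => f a ^ 2 - (2 * f m) * f a + f m ^ 2 := by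
      funext a; ring
    have i3 : Integrable (fun a => f a ^ 2 - (2 * f m) * f a) ν := iff2.sub (iff.const_mul _)
    rw [this, integral_add i3 (integrable_const _),
      integral_sub iff2 (iff.const_mul _), integral_sub iff (integrable_const _),
      integral_const_mul]
    simp
    ring
  have b1 : ‖∫ a, (f a - f m) ^ 2 ∂ν‖ ≤ c ^ 2 * v := by
    rw [hv', ← integral_const_mul]
    refine norm_integral_le_of_norm_le (i2.const_mul _) (ae_of_all _ fun a => ?_)
    rw [norm_pow, ← mul_pow, ← sq_abs (c * (a - m)), abs_mul]
    gcongr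
    refine (hc m a).trans ?_
    gcongr; exact le_abs_self c
  have b2 : ‖∫ a, (f a - f m) ∂ν‖ ≤ |c| * ∫ a, |a - m| ∂ν := by
    rw [← integral_const_mul]
    refine norm_integral_le_of_norm_le (i1.const_mul _) (ae_of_all _ fun a => ?_)
    refine (hc m a).trans ?_
    gcongr; exact le_abs_self c
  -- Cauchy–Schwarz, in the form of the nonnegativity of the variance of `|a - m|`.
  have b3 : (∫ a, |a - m| ∂ν) ^ 2 ≤ v := by
    have := variance_nonneg (fun a => |a - m|) ν
    rw [variance_eq_sub] at this
    · simp only [Pi.pow_apply, sq_abs] at this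
      rw [hv']; linarith
    · refine (memLp_two_iff_integrable_sq (by fun_prop)).2 ?_
      simpa using i2
  have b4 : ‖(∫ a, (f a - f m) ∂ν) ^ 2‖ ≤ c ^ 2 * v := by
    rw [norm_pow]
    calc ‖∫ a, (f a - f m) ∂ν‖ ^ 2 ≤ (|c| * ∫ a, |a - m| ∂ν) ^ 2 := by gcongr
      _ = c ^ 2 * (∫ a, |a - m| ∂ν) ^ 2 := by rw [mul_pow, sq_abs]
      _ ≤ c ^ 2 * v := by gcongr
  rw [e]
  have hvc : 0 ≤ c ^ 2 * v := mul_nonneg (sq_nonneg _) (variance_nonneg _ _)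
  linarith [norm_sub_le (∫ a, (f a - f m) ^ 2 ∂ν) ((∫ a, (f a - f m) ∂ν) ^ 2)]

variable {ι : Type*} [DecidableEq ι]

/-- A function of independent variables which is Lipschitz in each of the finitely many variables
it depends on has small fluctuations. -/
theorem norm_integral_sq_sub_sq_integral_le_card (h : AllMomentsExist ν) (S : Finset ι)
    {F : (ι → ℝ) → ℂ} {B c : ℝ} (hF : Measurable F) (hB : ∀ x, ‖F x‖ ≤ B)
    (hS : ∀ x y, (∀ i ∈ S, x i = y i) → F x = F y)
    (hc : ∀ i ∈ S, ∀ x b, ‖F (Function.update x i b) - F x‖ ≤ c * |b - x i|) :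
    ‖∫ x, F x ^ 2 ∂(Measure.infinitePi fun _ : ι => ν)
        - (∫ x, F x ∂(Measure.infinitePi fun _ : ι => ν)) ^ 2‖
      ≤ S.card * (4 * c ^ 2 * variance (fun x => x) ν) := by
  set P := Measure.infinitePi fun _ : ι => ν
  induction S using Finset.induction_on generalizing F with
  | empty =>
    have : F = fun _ => F 0 := funext fun x => hS _ _ (by simp)
    rw [this]
    simp
  | insert k S hk ih =>
    have iF : Integrable F P := .of_bound hF.aestronglyMeasurable B (ae_of_all _ hB)
    have iF2 : Integrable (fun x => F x ^ 2) P :=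
      .of_bound (hF.pow_const 2).aestronglyMeasurable (B ^ 2) (ae_of_all _ fun a => by
        rw [norm_pow]; gcongr; exact hB a)
    have hu (x : ι → ℝ) : Measurable fun a => Function.update x k a := measurable_update x
    have hupd (x : ι → ℝ) : Integrable (fun a => F (Function.update x k a)) ν :=
      .of_bound (hF.comp (hu x)).aestronglyMeasurable B (ae_of_all _ fun _ => hB _)
    -- Integrating out coordinate `k` gives a function of the coordinates in `S` with the same mean,
    -- bound and Lipschitz constants. The loss in the second moment is an average of one-variable
    -- fluctuations.
    set G : (ι → ℝ) → ℂ := fun x => ∫ a, F (Function.update x k a) ∂ν with hG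
    have mG : Measurable G := by
      have : StronglyMeasurable (fun p : (ι → ℝ) × ℝ => F (Function.update p.1 k p.2)) :=
        (hF.comp (measurable_update_prod k)).stronglyMeasurable
      exact this.integral_prod_right.measurable
    have hGB : ∀ x, ‖G x‖ ≤ B := fun x =>
      (norm_integral_le_of_norm_le_const (ae_of_all _ fun a => hB _)).trans (by simp)
    have hGS : ∀ x y, (∀ i ∈ S, x i = y i) → G x = G y := fun x y hxy => by
      simp only [hG]
      congr 1
      funext a
      refine hS _ _ fun i hi => ?_
      by_cases hik : i = k
      · subst hik; simp
      · simp only [Function.update_of_ne hik]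
        exact hxy i (Finset.mem_of_mem_insert_of_ne hi hik)
    have hGc : ∀ i ∈ S, ∀ x b, ‖G (Function.update x i b) - G x‖ ≤ c * |b - x i| := by
      intro i hi x b
      have hik : i ≠ k := fun hh => hk (hh ▸ hi)
      simp only [hG]
      rw [← integral_sub (hupd _) (hupd _)]
      refine (norm_integral_le_of_norm_le_const (C := c * |b - x i|)
        (ae_of_all _ fun a => ?_)).trans (by simp)
      rw [Function.update_comm hik]
      simpa [Function.update_of_ne hik] using
        hc i (Finset.mem_insert_of_mem hi) (Function.update x k a) b
    have h1 := ih mG hGB hGS hGc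
    have e1 : ∫ x, G x ∂P = ∫ x, F x ∂P := integral_update ν k iF
    have iG2 : Integrable (fun x => G x ^ 2) P :=
      .of_bound (mG.pow_const 2).aestronglyMeasurable (B ^ 2) (ae_of_all _ fun a => by
        rw [norm_pow]; gcongr; exact hGB a)
    have h2 : ‖∫ x, F x ^ 2 ∂P - ∫ x, G x ^ 2 ∂P‖ ≤ 4 * c ^ 2 * variance (fun x => x) ν := by
      rw [← integral_update ν k iF2, ← integral_sub (integrable_integral_update ν k iF2) iG2]
      refine (norm_integral_le_of_norm_le_const (C := 4 * c ^ 2 * variance (fun x => x) ν)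
        (ae_of_all _ fun x => ?_)).trans (by simp)
      refine norm_integral_sq_sub_sq_integral_le h (hF.comp (hu x)) (fun _ => hB _)
        (fun a b => ?_)
      simpa using hc k (Finset.mem_insert_self _ _) (Function.update x k a) b
    rw [Finset.card_insert_of_notMem hk, ← e1]
    calc _ = ‖(∫ x, F x ^ 2 ∂P - ∫ x, G x ^ 2 ∂P)
          + (∫ x, G x ^ 2 ∂P - (∫ x, G x ∂P) ^ 2)‖ := by congr 1; ring
      _ ≤ _ := by
        refine (norm_add_le _ _).trans ?_
        push_cast
        linarith

end Concentration

/-! ### Entries, traces and the operator norm -/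

section MatrixNorm

open scoped Matrix.Norms.L2Operator

variable {n : Type*} [Fintype n] [DecidableEq n]

theorem sum_norm_sq_col_le_l2_opNorm_sq (A : Matrix n n ℂ) (j : n) :
    ∑ i, ‖A i j‖ ^ 2 ≤ ‖A‖ ^ 2 := by
  have h := A.l2_opNorm_mulVec (EuclideanSpace.single j 1)
  rw [PiLp.norm_single, norm_one, mul_one] at h
  have h2 := pow_le_pow_left₀ (norm_nonneg _) h 2
  rw [EuclideanSpace.norm_sq_eq] at h2
  simpa using h2

theorem norm_entry_le_l2_opNorm (A : Matrix n n ℂ) (i j : n) : ‖A i j‖ ≤ ‖A‖ := by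
  refine (sq_le_sq₀ (norm_nonneg _) (norm_nonneg _)).1
    (le_trans ?_ (sum_norm_sq_col_le_l2_opNorm_sq A j))
  exact Finset.single_le_sum (f := fun i => ‖A i j‖ ^ 2) (fun _ _ => by positivity)
    (Finset.mem_univ i)

theorem norm_trace_le_card_mul_l2_opNorm (A : Matrix n n ℂ) :
    ‖A.trace‖ ≤ Fintype.card n * ‖A‖ := by
  refine (norm_sum_le_of_le _ fun i _ => norm_entry_le_l2_opNorm A i i).trans ?_
  simp

theorem norm_sum_sq_entries_le (A : Matrix n n ℂ) :
    ‖∑ i, ∑ j, A j i ^ 2‖ ≤ Fintype.card n * ‖A‖ ^ 2 := by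
  refine (norm_sum_le_of_le _ fun i _ => ?_).trans (b := ∑ _i : n, ‖A‖ ^ 2) (by simp)
  refine le_trans (norm_sum_le _ _) ?_
  simpa using sum_norm_sq_col_le_l2_opNorm_sq A i

theorem norm_sum_sq_diag_le (A : Matrix n n ℂ) :
    ‖∑ i, A i i ^ 2‖ ≤ Fintype.card n * ‖A‖ ^ 2 := by
  refine (norm_sum_le_of_le _ fun i _ => ?_).trans (b := ∑ _i : n, ‖A‖ ^ 2) (by simp)
  rw [norm_pow]
  gcongr
  exact norm_entry_le_l2_opNorm A i i

/-- The sum is `⟨u, A u⟩` for the all-ones vector `u`, with `‖u‖² = n`. This gains a factor `√n`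
over bounding column by column, and is what makes the mean of the entries harmless. -/
theorem norm_sum_entries_le (A : Matrix n n ℂ) :
    ‖∑ i, ∑ j, A i j‖ ≤ Fintype.card n * ‖A‖ := by
  set u : EuclideanSpace ℂ n := WithLp.toLp 2 fun _ => 1
  have hu : ‖u‖ ^ 2 = Fintype.card n := by rw [EuclideanSpace.norm_sq_eq]; simp [u]
  have h := A.l2_opNorm_mulVec u
  set w := (EuclideanSpace.equiv n ℂ).symm (A.mulVec u) with hw
  have hin : inner ℂ u w = ∑ i, ∑ j, A i j := by
    simp [PiLp.inner_apply, u, hw, Matrix.mulVec, dotProduct]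
  rw [← hin]
  calc ‖inner ℂ u w‖ ≤ ‖u‖ * ‖w‖ := norm_inner_le_norm _ _
    _ ≤ ‖u‖ * (‖A‖ * ‖u‖) := by gcongr
    _ = ‖u‖ ^ 2 * ‖A‖ := by ring
    _ = _ := by rw [hu]

/-- The symmetric `0`-`1` matrix supported on the position `p`. -/
def positionMatrix (p : Sym2 n) : Matrix n n ℂ :=
  Matrix.of fun k l => if s(k, l) = p then 1 else 0

/-- By the C⋆-identity it suffices to bound the product with the adjoint, which is the coordinate
projection onto the indices in `p`. -/
theorem l2_opNorm_positionMatrix_le (p : Sym2 n) : ‖positionMatrix p‖ ≤ 1 := by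
  have h : (positionMatrix p).conjTranspose * positionMatrix p
      = Matrix.diagonal fun k => if k ∈ p then (1 : ℂ) else 0 := by
    induction p using Sym2.ind with | _ a b =>
    ext k l
    simp only [positionMatrix, Matrix.mul_apply, Matrix.conjTranspose_apply, Matrix.of_apply,
      Matrix.diagonal_apply, Sym2.mem_iff, apply_ite star, star_one, star_zero, ite_mul, one_mul,
      zero_mul]
    by_cases hka : k = a
    · subst hka
      rw [Finset.sum_eq_single b]
      · by_cases hkl : k = l <;> simp [hkl, Sym2.eq_swap]
        grind
      · intro c _ hc
        simp
        grind
      · simp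
    · by_cases hkb : k = b
      · subst hkb
        rw [Finset.sum_eq_single a]
        · by_cases hkl : k = l <;> simp [hkl]
          grind
        · intro c _ hc
          simp
          grind
        · simp
      · simp [hka, hkb]
  have h1 : ‖positionMatrix p‖ * ‖positionMatrix p‖ ≤ 1 := by
    rw [← Matrix.l2_opNorm_conjTranspose_mul_self, h, Matrix.l2_opNorm_diagonal]
    refine (pi_norm_le_iff_of_nonneg zero_le_one).2 fun k => ?_
    split_ifs <;> simp
  nlinarith [norm_nonneg (positionMatrix p)]

/-- Up to sign and scaling this is the derivative of a resolvent entry in the matrix entry at the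
transposed position. Summed over `i, j`, the terms `A j j * A i i` form the squared trace, the
source of the quadratic term. The last term corrects the double count on the diagonal. -/
theorem mul_positionMatrix_mul_apply (A : Matrix n n ℂ) (i j : n) :
    (A * positionMatrix s(i, j) * A) j i
      = A j i ^ 2 + A j j * A i i - if i = j then A i i ^ 2 else 0 := by
  have h : positionMatrix s(i, j)
      = Matrix.single i j 1 + Matrix.single j i 1 - if i = j then Matrix.single i i 1 else 0 := by
    ext k l
    by_cases hij : i = j
    · subst hij
      simp only [positionMatrix, Matrix.of_apply, if_true, add_sub_cancel_right,
        Matrix.single_apply, Sym2.eq_iff]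
      grind
    · simp only [positionMatrix, Matrix.of_apply, hij, if_false, sub_zero, Matrix.add_apply,
        Matrix.single_apply, Sym2.eq_iff]
      grind
  rw [h]
  split_ifs with hij
  · subst hij
    simp [Matrix.mul_apply, Matrix.single_apply, ite_and]
  · simp [Matrix.mul_add, Matrix.mul_apply, Matrix.single_apply, ite_and, add_mul,
      Finset.sum_add_distrib]
    ring

end MatrixNorm

/-! ### The resolvent of a real symmetric matrix and its perturbation -/

section Resolvent

variable {n : Type*} [Fintype n] [DecidableEq n]

/-- The resolvent `(H - z)⁻¹` of a real matrix at a complex number `z`. -/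
def resolventMatrix (H : Matrix n n ℝ) (z : ℂ) : Matrix n n ℂ :=
  (H.map Complex.ofReal - z • 1)⁻¹

/-- The real diagonalization is transported entrywise to `ℂ`, so the eigenvalues in the resolvent
are the very ones used by `eigenvalueDistribution`. -/
theorem exists_unitary_map_ofReal_eq {H : Matrix n n ℝ} (hH : H.IsHermitian) :
    ∃ W ∈ unitary (Matrix n n ℂ),
      H.map Complex.ofReal = W * Matrix.diagonal (fun i => (hH.eigenvalues i : ℂ)) * star W := by
  set U : Matrix n n ℝ := (hH.eigenvectorUnitary : Matrix n n ℝ)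
  have hU : U * star U = 1 := Unitary.coe_mul_star_self _
  have hU' : star U * U = 1 := Unitary.coe_star_mul_self _
  have hstar : star (U.map Complex.ofReal) = (star U).map Complex.ofReal := by
    ext i j; simp [Matrix.star_apply]
  have hmul (A B : Matrix n n ℝ) : (A * B).map Complex.ofReal
      = A.map Complex.ofReal * B.map Complex.ofReal := Matrix.map_mul (f := Complex.ofRealHom)
  have hone : (1 : Matrix n n ℝ).map Complex.ofReal = 1 := by simp
  refine ⟨U.map Complex.ofReal, ?_, ?_⟩
  · rw [Unitary.mem_iff, hstar, ← hmul, ← hmul, hU, hU', hone]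
    exact ⟨rfl, rfl⟩
  · conv_lhs => rw [hH.spectral_theorem, Unitary.conjStarAlgAut_apply]
    rw [hmul, hmul, hstar, Matrix.diagonal_map (by simp)]
    rfl

theorem map_ofReal_sub_smul_one_mul {H : Matrix n n ℝ} (hH : H.IsHermitian) {z : ℂ}
    (hz : 0 < z.im) {W : Matrix n n ℂ} (hW : W ∈ unitary (Matrix n n ℂ))
    (hHW : H.map Complex.ofReal
      = W * Matrix.diagonal (fun i => (hH.eigenvalues i : ℂ)) * star W) :
    (H.map Complex.ofReal - z • 1) *
      (W * Matrix.diagonal (fun i => ((hH.eigenvalues i : ℂ) - z)⁻¹) * star W) = 1 := by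
  obtain ⟨h1, h2⟩ := Unitary.mem_iff.1 hW
  have h3 : z • (1 : Matrix n n ℂ) = W * Matrix.diagonal (fun _ => z) * star W := by
    rw [← Matrix.smul_one_eq_diagonal, Matrix.mul_smul, Matrix.smul_mul, mul_one, h2]
  have h4 (i : n) : ((hH.eigenvalues i : ℂ) - z) * ((hH.eigenvalues i : ℂ) - z)⁻¹ = 1 := by
    refine mul_inv_cancel₀ fun h => ?_
    have := congrArg Complex.im h
    simp at this
    exact hz.ne' this
  rw [hHW, h3, ← Matrix.sub_mul, ← Matrix.mul_sub, Matrix.diagonal_sub]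
  calc _ = W * Matrix.diagonal (fun i => (hH.eigenvalues i : ℂ) - z) * (star W * W)
        * Matrix.diagonal (fun i => ((hH.eigenvalues i : ℂ) - z)⁻¹) * star W := by
        simp only [Matrix.mul_assoc]
    _ = 1 := by
        rw [h1, Matrix.mul_one, Matrix.mul_assoc W, Matrix.diagonal_mul_diagonal]
        simp only [h4, Matrix.diagonal_one, Matrix.mul_one, h2]

theorem sub_mul_resolventMatrix {H : Matrix n n ℝ} (hH : H.IsHermitian) {z : ℂ}
    (hz : 0 < z.im) : (H.map Complex.ofReal - z • 1) * resolventMatrix H z = 1 := by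
  obtain ⟨W, hW, hHW⟩ := exists_unitary_map_ofReal_eq hH
  have h := map_ofReal_sub_smul_one_mul hH hz hW hHW
  rw [resolventMatrix, Matrix.inv_eq_right_inv h, h]

theorem resolventMatrix_mul_sub {H : Matrix n n ℝ} (hH : H.IsHermitian) {z : ℂ}
    (hz : 0 < z.im) : resolventMatrix H z * (H.map Complex.ofReal - z • 1) = 1 :=
  mul_eq_one_comm.1 (sub_mul_resolventMatrix hH hz)

theorem trace_resolventMatrix {H : Matrix n n ℝ} (hH : H.IsHermitian) {z : ℂ} (hz : 0 < z.im) :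
    (resolventMatrix H z).trace = ∑ i, ((hH.eigenvalues i : ℂ) - z)⁻¹ := by
  obtain ⟨W, hW, hHW⟩ := exists_unitary_map_ofReal_eq hH
  rw [resolventMatrix, Matrix.inv_eq_right_inv (map_ofReal_sub_smul_one_mul hH hz hW hHW),
    Matrix.trace_mul_comm, ← Matrix.mul_assoc, (Unitary.mem_iff.1 hW).1, Matrix.one_mul,
    Matrix.trace_diagonal]

theorem norm_inv_ofReal_sub_le {z : ℂ} (hz : 0 < z.im) (x : ℝ) :
    ‖((x : ℂ) - z)⁻¹‖ ≤ z.im⁻¹ := by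
  rw [norm_inv]
  refine inv_anti₀ hz ?_
  have := Complex.abs_im_le_norm ((x : ℂ) - z)
  simp only [Complex.sub_im, Complex.ofReal_im, zero_sub, abs_neg] at this
  exact (le_abs_self _).trans this

/-- Cramer's rule: determinant and adjugate are polynomials in the entries. The junk value of the
inverse keeps the formula valid for singular matrices. -/
theorem measurable_resolventMatrix_apply {Ω : Type*} [MeasurableSpace Ω]
    {H : Ω → Matrix n n ℝ} (hH : ∀ i j, Measurable fun ω => H ω i j) (z : ℂ) (i j : n) :
    Measurable fun ω => resolventMatrix (H ω) z i j := by
  have h (A : Matrix n n ℂ) : A⁻¹ i j = A.det⁻¹ * A.adjugate i j := by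
    rw [Matrix.inv_def]; simp
  simp only [resolventMatrix, h]
  have hent (k l : n) : Measurable fun ω => ((H ω).map Complex.ofReal - z • 1) k l := by
    simp only [Matrix.sub_apply, Matrix.map_apply]
    exact (Complex.measurable_ofReal.comp (hH k l)).sub measurable_const
  have hdet {F : Ω → Matrix n n ℂ} (hF : ∀ k l, Measurable fun ω => F ω k l) :
      Measurable fun ω => (F ω).det := by
    simp only [Matrix.det_apply]
    refine Finset.measurable_fun_sum _ fun σ _ => ?_
    refine Measurable.const_smul (Finset.measurable_fun_prod _ fun k _ => hF _ _) _
  refine (hdet hent).inv.mul ?_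
  simp only [Matrix.adjugate_apply]
  refine hdet fun k l => ?_
  simp only [Matrix.updateRow_apply]
  split_ifs
  · exact measurable_const
  · exact hent k l

open scoped Matrix.Norms.L2Operator

theorem l2_opNorm_resolventMatrix_le {H : Matrix n n ℝ} (hH : H.IsHermitian) {z : ℂ}
    (hz : 0 < z.im) : ‖resolventMatrix H z‖ ≤ z.im⁻¹ := by
  obtain ⟨W, hW, hHW⟩ := exists_unitary_map_ofReal_eq hH
  rw [resolventMatrix, Matrix.inv_eq_right_inv (map_ofReal_sub_smul_one_mul hH hz hW hHW),
    CStarRing.norm_mul_mem_unitary _ (Unitary.star_mem hW), CStarRing.norm_mem_unitary_mul _ hW,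
    Matrix.l2_opNorm_diagonal]
  exact (pi_norm_le_iff_of_nonneg (by positivity)).2 fun i => norm_inv_ofReal_sub_le hz _

variable {H H' : Matrix n n ℝ} {z t : ℂ} {D : Matrix n n ℂ}

theorem resolventMatrix_sub_eq (hH : H.IsHermitian) (hH' : H'.IsHermitian) (hz : 0 < z.im)
    (hD : H'.map Complex.ofReal = H.map Complex.ofReal + t • D) :
    resolventMatrix H' z - resolventMatrix H z
      = -(t • (resolventMatrix H z * D * resolventMatrix H' z)) := by
  have h1 := resolventMatrix_mul_sub hH hz
  have h2 := sub_mul_resolventMatrix hH' hz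
  have h3 : t • D = (H'.map Complex.ofReal - z • 1) - (H.map Complex.ofReal - z • 1) := by
    rw [hD]; abel
  rw [← Matrix.smul_mul, ← Matrix.mul_smul, h3, Matrix.mul_sub, h1, Matrix.sub_mul,
    Matrix.mul_assoc, h2]
  simp

theorem l2_opNorm_mul_mul_le {A B : Matrix n n ℂ} {a b : ℝ} (hA : ‖A‖ ≤ a) (hB : ‖B‖ ≤ b)
    (hD : ‖D‖ ≤ 1) : ‖A * D * B‖ ≤ a * b := by
  have ha : 0 ≤ a := (norm_nonneg _).trans hA
  calc ‖A * D * B‖ ≤ ‖A‖ * ‖D‖ * ‖B‖ :=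
        (norm_mul_le _ _).trans (by gcongr; exact norm_mul_le _ _)
    _ ≤ a * 1 * b := by gcongr
    _ = a * b := by ring

theorem l2_opNorm_resolventMatrix_sub_le (hH : H.IsHermitian) (hH' : H'.IsHermitian)
    (hz : 0 < z.im) (hD : H'.map Complex.ofReal = H.map Complex.ofReal + t • D)
    (hD1 : ‖D‖ ≤ 1) :
    ‖resolventMatrix H' z - resolventMatrix H z‖ ≤ ‖t‖ * z.im⁻¹ ^ 2 := by
  rw [resolventMatrix_sub_eq hH hH' hz hD, norm_neg, norm_smul, sq]
  gcongr
  exact l2_opNorm_mul_mul_le (l2_opNorm_resolventMatrix_le hH hz)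
    (l2_opNorm_resolventMatrix_le hH' hz) hD1

/-- The resolvent identity is inserted into itself; `-G D G` is the derivative in direction `D`, and
the remainder contains three resolvents and `t` twice. -/
theorem l2_opNorm_resolventMatrix_second_order_le (hH : H.IsHermitian) (hH' : H'.IsHermitian)
    (hz : 0 < z.im) (hD : H'.map Complex.ofReal = H.map Complex.ofReal + t • D)
    (hD1 : ‖D‖ ≤ 1) :
    ‖resolventMatrix H' z - resolventMatrix H z
        + t • (resolventMatrix H z * D * resolventMatrix H z)‖ ≤ ‖t‖ ^ 2 * z.im⁻¹ ^ 3 := by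
  have e : resolventMatrix H' z - resolventMatrix H z
        + t • (resolventMatrix H z * D * resolventMatrix H z)
      = -(t • (resolventMatrix H z * D * (resolventMatrix H' z - resolventMatrix H z))) := by
    rw [resolventMatrix_sub_eq hH hH' hz hD, ← resolventMatrix_sub_eq hH hH' hz hD,
      Matrix.mul_sub, smul_sub]
    nth_rewrite 1 [resolventMatrix_sub_eq hH hH' hz hD]
    abel
  rw [e, norm_neg, norm_smul]
  calc _ ≤ ‖t‖ * (z.im⁻¹ * (‖t‖ * z.im⁻¹ ^ 2)) := by
        gcongr
        exact l2_opNorm_mul_mul_le (l2_opNorm_resolventMatrix_le hH hz)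
          (l2_opNorm_resolventMatrix_sub_le hH hH' hz hD hD1) hD1
    _ = _ := by ring

theorem l2_opNorm_resolventMatrix_conj_sub_le (hH : H.IsHermitian) (hH' : H'.IsHermitian)
    (hz : 0 < z.im) (hD : H'.map Complex.ofReal = H.map Complex.ofReal + t • D)
    (hD1 : ‖D‖ ≤ 1) :
    ‖resolventMatrix H' z * D * resolventMatrix H' z
        - resolventMatrix H z * D * resolventMatrix H z‖ ≤ 2 * ‖t‖ * z.im⁻¹ ^ 3 := by
  have hsub := l2_opNorm_resolventMatrix_sub_le hH hH' hz hD hD1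
  have e : resolventMatrix H' z * D * resolventMatrix H' z
        - resolventMatrix H z * D * resolventMatrix H z
      = (resolventMatrix H' z - resolventMatrix H z) * D * resolventMatrix H' z
        + resolventMatrix H z * D * (resolventMatrix H' z - resolventMatrix H z) := by
    simp only [Matrix.sub_mul, Matrix.mul_sub]; abel
  rw [e]
  have h1 := l2_opNorm_mul_mul_le hsub (l2_opNorm_resolventMatrix_le hH' hz) hD1
  have h2 := l2_opNorm_mul_mul_le (l2_opNorm_resolventMatrix_le hH hz) hsub hD1
  refine (norm_add_le _ _).trans ?_
  linarith

end Resolvent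
open scoped Matrix.Norms.L2Operator in
-- At most two entries of `A` contribute, so no factor of the dimension appears.
theorem norm_trace_positionMatrix_mul_le {n : Type*} [Fintype n] [DecidableEq n] (p : Sym2 n)
    (A : Matrix n n ℂ) : ‖(positionMatrix p * A).trace‖ ≤ 2 * ‖A‖ := by
  induction p using Sym2.ind with | _ i j =>
  have h : (positionMatrix s(i, j) * A).trace
      = if i = j then A i i else A i j + A j i := by
    have hp : positionMatrix s(i, j)
        = if i = j then Matrix.single i i 1 else Matrix.single i j 1 + Matrix.single j i 1 := by
      ext k l
      split_ifs with hij <;>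
        simp only [positionMatrix, Matrix.of_apply, Matrix.add_apply, Matrix.single_apply,
          Sym2.eq_iff] <;> grind
    rw [hp]
    split_ifs
    · simp [Matrix.trace_single_mul]
    · simp [Matrix.add_mul, Matrix.trace_single_mul, add_comm]
  rw [h]
  have h1 := norm_entry_le_l2_opNorm A
  split_ifs
  · linarith [h1 i i, norm_nonneg A]
  · linarith [norm_add_le (A i j) (A j i), h1 i j, h1 j i]

/-! ### The self-consistent equation for i.i.d. entries -/

section Ensemble

variable {N : ℕ} (e : Sym2 (Fin N) ↪ ℕ) (z : ℂ)

/-- The normalized trace of the resolvent of `X_N / √N`. -/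
def resolventTrace (ξ : ℕ → ℝ) : ℂ :=
  (resolventMatrix (normalizedMatrix e ξ) z).trace / N

/-- Since `e` is injective, changing one member of the sequence moves only the position `p` and its
mirror image. -/
theorem map_normalizedMatrix_update (ξ : ℕ → ℝ) (p : Sym2 (Fin N)) (b : ℝ) :
    (normalizedMatrix e (Function.update ξ (e p) b)).map Complex.ofReal
      = (normalizedMatrix e ξ).map Complex.ofReal
        + (((√(N : ℝ))⁻¹ * (b - ξ (e p)) : ℝ) : ℂ) • positionMatrix p := by
  ext k l
  simp only [normalizedMatrix, ensembleMatrix, positionMatrix, Matrix.map_apply,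
    Matrix.smul_apply, Matrix.of_apply, Matrix.add_apply, smul_eq_mul]
  by_cases h : s(k, l) = p
  · rw [h, Function.update_self]
    push_cast
    simp
    ring
  · rw [Function.update_of_ne (fun h' => h (e.injective h'))]
    simp [h]

theorem measurable_normalizedMatrix_apply (i j : Fin N) :
    Measurable fun ξ => normalizedMatrix e ξ i j := by
  simp only [normalizedMatrix, ensembleMatrix, Matrix.smul_apply, Matrix.of_apply, smul_eq_mul]
  fun_prop

theorem measurable_resolventMatrix_normalizedMatrix_apply (i j : Fin N) :
    Measurable fun ξ => resolventMatrix (normalizedMatrix e ξ) z i j :=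
  measurable_resolventMatrix_apply (measurable_normalizedMatrix_apply e) z i j

theorem measurable_resolventTrace : Measurable (resolventTrace e z) := by
  unfold resolventTrace Matrix.trace
  simp only [Matrix.diag]
  exact (Finset.measurable_fun_sum _ fun i _ =>
    measurable_resolventMatrix_normalizedMatrix_apply e z i i).div_const _

theorem inv_sqrt_sq_natCast (N : ℕ) : ((√(N : ℝ))⁻¹) ^ 2 = (N : ℝ)⁻¹ := by
  rw [inv_pow, Real.sq_sqrt (Nat.cast_nonneg N)]

variable {z}

open scoped Matrix.Norms.L2Operator

theorem norm_resolventTrace_le (hz : 0 < z.im) (ξ : ℕ → ℝ) :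
    ‖resolventTrace e z ξ‖ ≤ z.im⁻¹ := by
  have hη : 0 ≤ z.im⁻¹ := by positivity
  rcases Nat.eq_zero_or_pos N with rfl | hN
  · simpa [resolventTrace] using hη
  rw [resolventTrace, norm_div, Complex.norm_natCast, div_le_iff₀' (by positivity)]
  refine (norm_trace_le_card_mul_l2_opNorm _).trans ?_
  rw [Fintype.card_fin]
  gcongr
  exact l2_opNorm_resolventMatrix_le (normalizedMatrix_isHermitian e ξ) hz

/-- Cyclicity of the trace brings the position matrix to the front, where it meets a product of two
resolvents. The Lipschitz constant is therefore of order `N ^ (-3/2)`. -/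
theorem norm_resolventTrace_update_sub_le (hz : 0 < z.im) (ξ : ℕ → ℝ) (p : Sym2 (Fin N))
    (b : ℝ) :
    ‖resolventTrace e z (Function.update ξ (e p) b) - resolventTrace e z ξ‖
      ≤ (2 * (√(N : ℝ))⁻¹ * z.im⁻¹ ^ 2 / N) * |b - ξ (e p)| := by
  have hH := normalizedMatrix_isHermitian e ξ
  have hH' := normalizedMatrix_isHermitian e (Function.update ξ (e p) b)
  rw [resolventTrace, resolventTrace, ← sub_div, ← Matrix.trace_sub,
    resolventMatrix_sub_eq hH hH' hz (map_normalizedMatrix_update e ξ p b),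
    Matrix.trace_neg, Matrix.trace_smul, Matrix.mul_assoc, Matrix.trace_mul_comm,
    Matrix.mul_assoc, norm_div, norm_neg, norm_smul, Complex.norm_natCast, Complex.norm_real,
    Real.norm_eq_abs, abs_mul, abs_of_nonneg (by positivity : 0 ≤ (√(N : ℝ))⁻¹)]
  rw [div_mul_eq_mul_div]
  refine div_le_div_of_nonneg_right ?_ (Nat.cast_nonneg N)
  have h1 := norm_trace_positionMatrix_mul_le p
    (resolventMatrix (normalizedMatrix e (Function.update ξ (e p) b)) z
      * resolventMatrix (normalizedMatrix e ξ) z)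
  have h2 : ‖resolventMatrix (normalizedMatrix e (Function.update ξ (e p) b)) z
      * resolventMatrix (normalizedMatrix e ξ) z‖ ≤ z.im⁻¹ * z.im⁻¹ := by
    refine (norm_mul_le _ _).trans ?_
    gcongr
    · exact l2_opNorm_resolventMatrix_le hH' hz
    · exact l2_opNorm_resolventMatrix_le hH hz
  calc _ ≤ (√(N : ℝ))⁻¹ * |b - ξ (e p)| * (2 * (z.im⁻¹ * z.im⁻¹)) := by
        gcongr
        exact h1.trans (by gcongr)
    _ = _ := by ring

variable {ν : Measure ℝ} [IsProbabilityMeasure ν]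

/-- There are at most `N ^ 2` variables, each with squared Lipschitz constant of order `N ^ (-3)`.
-/
theorem norm_integral_resolventTrace_sq_sub_le (h : AllMomentsExist ν) (hN : 0 < N)
    (hz : 0 < z.im) :
    ‖∫ ξ, resolventTrace e z ξ ^ 2 ∂(iidLaw ν) - (∫ ξ, resolventTrace e z ξ ∂(iidLaw ν)) ^ 2‖
      ≤ 16 * z.im⁻¹ ^ 4 * variance (fun x => x) ν * (N : ℝ)⁻¹ := by
  have h0 := norm_integral_sq_sub_sq_integral_le_card h (Finset.univ.map e)
    (measurable_resolventTrace e z) (norm_resolventTrace_le e hz)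
    (c := 2 * (√(N : ℝ))⁻¹ * z.im⁻¹ ^ 2 / N) (fun x y hxy => ?_) (fun i hi x b => ?_)
  · refine h0.trans ?_
    rw [Finset.card_map, Finset.card_univ]
    have hcard : (Fintype.card (Sym2 (Fin N)) : ℝ) ≤ (N : ℝ) ^ 2 := by
      have : Fintype.card (Sym2 (Fin N)) ≤ Fintype.card (Fin N × Fin N) :=
        Fintype.card_le_of_surjective (fun p => s(p.1, p.2)) Sym2.mk_surjective
      rw [Fintype.card_prod, Fintype.card_fin] at this
      exact_mod_cast this.trans_eq (sq N).symm
    have hv : 0 ≤ variance (fun x => x) ν := variance_nonneg _ _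
    have hN' : (N : ℝ) ≠ 0 := by positivity
    calc _ ≤ (N : ℝ) ^ 2 * (4 * (2 * (√(N : ℝ))⁻¹ * z.im⁻¹ ^ 2 / N) ^ 2
          * variance (fun x => x) ν) := by gcongr
      _ = 16 * z.im⁻¹ ^ 4 * variance (fun x => x) ν * ((√(N : ℝ))⁻¹) ^ 2 := by
          generalize (√(N : ℝ))⁻¹ = r
          field_simp
          ring
      _ = _ := by rw [inv_sqrt_sq_natCast]
  · have : normalizedMatrix e x = normalizedMatrix e y := by
      simp only [normalizedMatrix, ensembleMatrix]
      congr 2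
      ext i j
      exact hxy _ (Finset.mem_map_of_mem e (Finset.mem_univ _))
    simp only [resolventTrace, this]
  · obtain ⟨p, -, rfl⟩ := Finset.mem_map.1 hi
    exact norm_resolventTrace_update_sub_le e hz x p b

/-- The third-moment constant in the error of the cumulant expansion. -/
def cumulantError (ν : Measure ℝ) : ℝ :=
  ∫ a, |a - ∫ y, y ∂ν| ^ 3 ∂ν + variance (fun y => y) ν * ∫ a, |a - ∫ y, y ∂ν| ∂ν

theorem norm_integral_centered_mul_resolventMatrix_le (h : AllMomentsExist ν) (hz : 0 < z.im)
    (i j : Fin N) :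
    ‖∫ ξ, ((ξ (e s(i, j)) - ∫ y, y ∂ν : ℝ) : ℂ)
          * resolventMatrix (normalizedMatrix e ξ) z j i ∂(iidLaw ν)
        - (variance (fun y => y) ν : ℝ) * ∫ ξ, -(((√(N : ℝ))⁻¹ : ℝ) : ℂ)
          * (resolventMatrix (normalizedMatrix e ξ) z * positionMatrix s(i, j)
            * resolventMatrix (normalizedMatrix e ξ) z) j i ∂(iidLaw ν)‖
      ≤ 2 * z.im⁻¹ ^ 3 * (N : ℝ)⁻¹ * cumulantError ν := by
  have hr : 0 ≤ (√(N : ℝ))⁻¹ := by positivity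
  have hη : 0 ≤ z.im⁻¹ := by positivity
  have hD := l2_opNorm_positionMatrix_le s(i, j)
  have hH := normalizedMatrix_isHermitian e
  have hm := measurable_resolventMatrix_normalizedMatrix_apply e z
  have ht (ξ : ℕ → ℝ) (b : ℝ) : ‖(((√(N : ℝ))⁻¹ * (b - ξ (e s(i, j))) : ℝ) : ℂ)‖
      = (√(N : ℝ))⁻¹ * |b - ξ (e s(i, j))| := by
    rw [Complex.norm_real, Real.norm_eq_abs, abs_mul, abs_of_nonneg hr]
  -- `B` is a common bound for the entry and its derivative, needed for integrability only. The `2`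
  -- in the constant `K` comes from the Lipschitz bound on the derivative; the Taylor remainder
  -- would need only `1`.
  refine norm_integral_eval_sub_mean_mul_sub_variance_mul_le h (e s(i, j))
    (B := z.im⁻¹ + (√(N : ℝ))⁻¹ * (z.im⁻¹ * z.im⁻¹)) (hm j i) ?_ (fun ξ => ?_) (fun ξ => ?_)
    (fun ξ b => ?_) (fun ξ b => ?_)
  · simp only [Matrix.mul_apply]
    fun_prop
  · refine (norm_entry_le_l2_opNorm _ _ _).trans
      ((l2_opNorm_resolventMatrix_le (hH ξ) hz).trans ?_)
    have : 0 ≤ (√(N : ℝ))⁻¹ * (z.im⁻¹ * z.im⁻¹) := by positivity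
    linarith
  · rw [norm_mul, norm_neg, Complex.norm_real, Real.norm_of_nonneg hr]
    refine le_add_of_nonneg_of_le hη ?_
    gcongr
    refine (norm_entry_le_l2_opNorm _ _ _).trans ?_
    exact l2_opNorm_mul_mul_le (l2_opNorm_resolventMatrix_le (hH ξ) hz)
      (l2_opNorm_resolventMatrix_le (hH ξ) hz) hD
  · have h1 := (norm_entry_le_l2_opNorm _ j i).trans
      (l2_opNorm_resolventMatrix_second_order_le (hH ξ)
      (hH (Function.update ξ (e s(i, j)) b)) hz (map_normalizedMatrix_update e ξ s(i, j) b) hD)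
    rw [ht, mul_pow, inv_sqrt_sq_natCast] at h1
    refine le_trans (le_of_eq ?_) (h1.trans ?_)
    · congr 1
      simp only [Matrix.add_apply, Matrix.sub_apply, Matrix.smul_apply, smul_eq_mul]
      push_cast
      ring
    · have : 0 ≤ (N : ℝ)⁻¹ * |b - ξ (e s(i, j))| ^ 2 * z.im⁻¹ ^ 3 := by positivity
      linarith
  · have h1 := (norm_entry_le_l2_opNorm _ j i).trans
      (l2_opNorm_resolventMatrix_conj_sub_le (hH ξ)
      (hH (Function.update ξ (e s(i, j)) b)) hz (map_normalizedMatrix_update e ξ s(i, j) b) hD)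
    rw [ht, Matrix.sub_apply] at h1
    rw [← mul_sub, norm_mul, norm_neg, Complex.norm_real, Real.norm_of_nonneg hr]
    calc _ ≤ (√(N : ℝ))⁻¹ * (2 * ((√(N : ℝ))⁻¹ * |b - ξ (e s(i, j))|) * z.im⁻¹ ^ 3) := by gcongr
      _ = 2 * z.im⁻¹ ^ 3 * ((√(N : ℝ))⁻¹) ^ 2 * |b - ξ (e s(i, j))| := by ring
      _ = _ := by rw [inv_sqrt_sq_natCast]

theorem one_add_mul_resolventTrace (hN : 0 < N) (hz : 0 < z.im) (ξ : ℕ → ℝ) :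
    1 + z * resolventTrace e z ξ
      = (((√(N : ℝ))⁻¹ : ℝ) : ℂ) / N *
        ∑ i, ∑ j, (ξ (e s(i, j)) : ℂ) * resolventMatrix (normalizedMatrix e ξ) z j i := by
  have hN' : (N : ℂ) ≠ 0 := by exact_mod_cast hN.ne'
  have h := congrArg Matrix.trace (sub_mul_resolventMatrix (normalizedMatrix_isHermitian e ξ) hz)
  rw [Matrix.sub_mul, Matrix.trace_sub, Matrix.trace_one, Fintype.card_fin, Matrix.smul_mul,
    Matrix.one_mul, Matrix.trace_smul, smul_eq_mul, sub_eq_iff_eq_add] at h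
  have h2 : ((normalizedMatrix e ξ).map Complex.ofReal
        * resolventMatrix (normalizedMatrix e ξ) z).trace
      = (((√(N : ℝ))⁻¹ : ℝ) : ℂ) *
        ∑ i, ∑ j, (ξ (e s(i, j)) : ℂ) * resolventMatrix (normalizedMatrix e ξ) z j i := by
    simp only [Matrix.trace, Matrix.diag, Matrix.mul_apply, Finset.mul_sum]
    refine Finset.sum_congr rfl fun i _ => Finset.sum_congr rfl fun j _ => ?_
    conv_lhs => enter [1]; rw [normalizedMatrix]
    simp only [ensembleMatrix, Matrix.map_apply, Matrix.smul_apply, Matrix.of_apply, smul_eq_mul]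
    push_cast
    ring
  rw [div_mul_eq_mul_div, ← h2, h, resolventTrace]
  field_simp

/-- The expected resolvent trace satisfies the quadratic equation of the Stieltjes transform of
the semicircle up to an error of order `N ^ (-1/2)`. -/
theorem norm_self_consistent_le (h : AllMomentsExist ν) (hN : 0 < N) (hz : 0 < z.im) :
    ‖1 + z * ∫ ξ, resolventTrace e z ξ ∂(iidLaw ν)
        + (variance (fun x => x) ν : ℝ) * (∫ ξ, resolventTrace e z ξ ∂(iidLaw ν)) ^ 2‖
      ≤ (|∫ y, y ∂ν| * z.im⁻¹ + 2 * z.im⁻¹ ^ 3 * cumulantError ν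
          + 2 * variance (fun x => x) ν * z.im⁻¹ ^ 2
          + 16 * z.im⁻¹ ^ 4 * variance (fun x => x) ν ^ 2) * (√(N : ℝ))⁻¹ := by
  have : IsProbabilityMeasure (iidLaw ν) := by unfold iidLaw; infer_instance
  set P := iidLaw ν
  set M := ∫ y, y ∂ν
  set v := variance (fun x => x) ν
  set r := (√(N : ℝ))⁻¹ with hr_def
  set G : (ℕ → ℝ) → Matrix (Fin N) (Fin N) ℂ :=
    fun ξ => resolventMatrix (normalizedMatrix e ξ) z with hG
  set s := resolventTrace e z
  have hv : 0 ≤ v := variance_nonneg _ _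
  have hr : 0 ≤ r := by positivity
  have hη : 0 ≤ z.im⁻¹ := by positivity
  have hr2 : r ^ 2 = (N : ℝ)⁻¹ := inv_sqrt_sq_natCast N
  have hNr : (0 : ℝ) < N := by exact_mod_cast hN
  have hNc : (N : ℂ) ≠ 0 := by exact_mod_cast hN.ne'
  -- As `N ≥ 1`, errors of order `N⁻¹` can be absorbed into `r = N ^ (-1/2)`.
  have hr1 : r ≤ 1 := inv_le_one_of_one_le₀ (Real.one_le_sqrt.2 (by exact_mod_cast hN))
  have hNinv : (N : ℝ)⁻¹ ≤ r := by rw [← hr2]; nlinarith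
  have hGn (ξ) : ‖G ξ‖ ≤ z.im⁻¹ :=
    l2_opNorm_resolventMatrix_le (normalizedMatrix_isHermitian e ξ) hz
  have mG (i j) : Measurable fun ξ => G ξ i j :=
    measurable_resolventMatrix_normalizedMatrix_apply e z i j
  have iG (i j) : Integrable (fun ξ => G ξ i j) P :=
    .of_bound (mG i j).aestronglyMeasurable z.im⁻¹
      (ae_of_all _ fun ξ => (norm_entry_le_l2_opNorm _ _ _).trans (hGn ξ))
  have icG (i j) : Integrable (fun ξ => ((ξ (e s(i, j)) - M : ℝ) : ℂ) * G ξ j i) P :=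
    (integrable_eval_infinitePi h _ M).ofReal.mul_bdd (mG j i).aestronglyMeasurable
      (ae_of_all _ fun ξ => (norm_entry_le_l2_opNorm _ _ _).trans (hGn ξ))
  have is : Integrable s P := .of_bound (measurable_resolventTrace e z).aestronglyMeasurable
    z.im⁻¹ (ae_of_all _ (norm_resolventTrace_le e hz))
  have is2 : Integrable (fun ξ => s ξ ^ 2) P :=
    .of_bound ((measurable_resolventTrace e z).pow_const 2).aestronglyMeasurable
      (z.im⁻¹ ^ 2) (ae_of_all _ fun ξ => by
        rw [norm_pow]; gcongr; exact norm_resolventTrace_le e hz ξ)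
  set Q : Fin N → Fin N → (ℕ → ℝ) → ℂ :=
    fun i j ξ => -(r : ℂ) * (G ξ * positionMatrix s(i, j) * G ξ) j i with hQ
  have iQ (i j) : Integrable (Q i j) P := by
    refine .of_bound (C := r * (z.im⁻¹ * z.im⁻¹)) ?_ (ae_of_all _ fun ξ => ?_)
    · refine Measurable.aestronglyMeasurable ?_
      simp only [hQ, Matrix.mul_apply]
      fun_prop
    · rw [hQ, norm_mul, norm_neg, Complex.norm_real, Real.norm_of_nonneg hr]
      gcongr
      exact (norm_entry_le_l2_opNorm _ _ _).trans
        (l2_opNorm_mul_mul_le (hGn ξ) (hGn ξ) (l2_opNorm_positionMatrix_le _))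
  -- The `N ^ 2` expansion errors are each `O(N⁻¹)`; with the prefactor `N ^ (-3/2)` their total is
  -- `O(N ^ (-1/2))`.
  set err : Fin N → Fin N → ℂ := fun i j =>
    ∫ ξ, ((ξ (e s(i, j)) - M : ℝ) : ℂ) * G ξ j i ∂P - v * ∫ ξ, Q i j ξ ∂P with herr
  have herr_le (i j) : ‖err i j‖ ≤ 2 * z.im⁻¹ ^ 3 * (N : ℝ)⁻¹ * cumulantError ν :=
    norm_integral_centered_mul_resolventMatrix_le e h hz i j
  -- the expectation of the trace identity
  have E1 : 1 + z * ∫ ξ, s ξ ∂P = (r : ℂ) / N * (M * ∫ ξ, ∑ i, ∑ j, G ξ i j ∂P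
      + ∑ i, ∑ j, err i j + v * ∫ ξ, ∑ i, ∑ j, Q i j ξ ∂P) := by
    have e1 : 1 + z * ∫ ξ, s ξ ∂P = ∫ ξ, (1 + z * s ξ) ∂P := by
      rw [integral_add (integrable_const _) (is.const_mul _), integral_const_mul]
      simp
    have e2 (ξ) : 1 + z * s ξ = (r : ℂ) / N * (M * ∑ i, ∑ j, G ξ i j
        + ∑ i, ∑ j, ((ξ (e s(i, j)) - M : ℝ) : ℂ) * G ξ j i) := by
      rw [one_add_mul_resolventTrace e hN hz ξ, Finset.sum_comm (f := fun i j => G ξ i j)]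
      congr 1
      simp only [Finset.mul_sum, ← Finset.sum_add_distrib]
      refine Finset.sum_congr rfl fun i _ => Finset.sum_congr rfl fun j _ => ?_
      push_cast
      ring
    have i1 : Integrable (fun ξ => ∑ i, ∑ j, G ξ i j) P :=
      integrable_finsetSum _ fun i _ => integrable_finsetSum _ fun j _ => iG i j
    have i2 : Integrable (fun ξ => ∑ i, ∑ j, ((ξ (e s(i, j)) - M : ℝ) : ℂ) * G ξ j i) P :=
      integrable_finsetSum _ fun i _ => integrable_finsetSum _ fun j _ => icG i j
    have e3 : ∫ ξ, ∑ i, ∑ j, ((ξ (e s(i, j)) - M : ℝ) : ℂ) * G ξ j i ∂P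
        = ∑ i, ∑ j, err i j + v * ∫ ξ, ∑ i, ∑ j, Q i j ξ ∂P := by
      rw [integral_finsetSum _ fun i _ => integrable_finsetSum _ fun j _ => icG i j,
        integral_finsetSum _ fun i _ => integrable_finsetSum _ fun j _ => iQ i j,
        Finset.mul_sum, ← Finset.sum_add_distrib]
      refine Finset.sum_congr rfl fun i _ => ?_
      rw [integral_finsetSum _ fun j _ => icG i j, integral_finsetSum _ fun j _ => iQ i j,
        Finset.mul_sum, ← Finset.sum_add_distrib]
      refine Finset.sum_congr rfl fun j _ => ?_
      rw [herr]
      ring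
    rw [e1]
    simp only [e2]
    rw [integral_const_mul, integral_add (i1.const_mul _) i2, integral_const_mul, e3]
    ring
  -- The squared trace inside the sum of the `Q i j` cancels `s ξ ^ 2`. What remains are sums of
  -- squared entries, of size `O(N)` before the division by `N ^ 2`.
  have E2 (ξ) : (r : ℂ) / N * ∑ i, ∑ j, Q i j ξ + s ξ ^ 2
      = -((∑ i, ∑ j, G ξ j i ^ 2) - ∑ i, G ξ i i ^ 2) / (N : ℂ) ^ 2 := by
    have hs : s ξ = (∑ i, G ξ i i) / N := rfl
    have hr2c : (r : ℂ) ^ 2 = (N : ℂ)⁻¹ := by rw [← Complex.ofReal_pow, hr2]; push_cast; rfl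
    have hsum : ∑ i, ∑ j, Q i j ξ = -(r : ℂ) * ((∑ i, ∑ j, G ξ j i ^ 2)
        + (∑ i, G ξ i i) ^ 2 - ∑ i, G ξ i i ^ 2) := by
      simp only [hQ, mul_positionMatrix_mul_apply, ← Finset.mul_sum, Finset.sum_sub_distrib,
        Finset.sum_add_distrib, Finset.sum_ite_eq, Finset.mem_univ, if_true, sq (∑ i, G ξ i i)]
      congr 3
      rw [Finset.sum_mul_sum, Finset.sum_comm]
    have : (r : ℂ) / N * ∑ i, ∑ j, Q i j ξ = -((r : ℂ) ^ 2 / N * ((∑ i, ∑ j, G ξ j i ^ 2)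
        + (∑ i, G ξ i i) ^ 2 - ∑ i, G ξ i i ^ 2)) := by rw [hsum]; ring
    rw [this, hr2c, hs]
    field_simp
    ring
  have iQs : Integrable (fun ξ => ∑ i, ∑ j, Q i j ξ) P :=
    integrable_finsetSum _ fun i _ => integrable_finsetSum _ fun j _ => iQ i j
  have E3 : (r : ℂ) / N * ∫ ξ, ∑ i, ∑ j, Q i j ξ ∂P + ∫ ξ, s ξ ^ 2 ∂P
      = ∫ ξ, ((r : ℂ) / N * ∑ i, ∑ j, Q i j ξ + s ξ ^ 2) ∂P := by
    rw [integral_add (iQs.const_mul _) is2, integral_const_mul]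
  have B1 : ‖(r : ℂ) / N * (M * ∫ ξ, ∑ i, ∑ j, G ξ i j ∂P)‖ ≤ |M| * z.im⁻¹ * r := by
    have : ‖∫ ξ, ∑ i, ∑ j, G ξ i j ∂P‖ ≤ N * z.im⁻¹ := by
      refine (norm_integral_le_of_norm_le_const (C := N * z.im⁻¹)
        (ae_of_all _ fun ξ => ?_)).trans (by simp)
      refine (norm_sum_entries_le _).trans ?_
      rw [Fintype.card_fin]
      gcongr
      exact hGn ξ
    rw [norm_mul, norm_mul, norm_div, Complex.norm_real, Complex.norm_real, Complex.norm_natCast,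
      Real.norm_of_nonneg hr, Real.norm_eq_abs]
    calc _ ≤ r / N * (|M| * (N * z.im⁻¹)) := by gcongr
      _ = _ := by field_simp
  have B2 : ‖(r : ℂ) / N * ∑ i, ∑ j, err i j‖ ≤ 2 * z.im⁻¹ ^ 3 * cumulantError ν * r := by
    have : ‖∑ i, ∑ j, err i j‖ ≤ N * (N * (2 * z.im⁻¹ ^ 3 * (N : ℝ)⁻¹ * cumulantError ν)) := by
      refine (norm_sum_le_of_le _ fun i _ => norm_sum_le_of_le _ fun j _ => herr_le i j).trans ?_
      simp
    rw [norm_mul, norm_div, Complex.norm_real, Complex.norm_natCast, Real.norm_of_nonneg hr]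
    calc _ ≤ r / N * (N * (N * (2 * z.im⁻¹ ^ 3 * (N : ℝ)⁻¹ * cumulantError ν))) := by gcongr
      _ = _ := by field_simp
  have B3 : ‖(v : ℂ) * ((r : ℂ) / N * ∫ ξ, ∑ i, ∑ j, Q i j ξ ∂P + ∫ ξ, s ξ ^ 2 ∂P)‖
      ≤ 2 * v * z.im⁻¹ ^ 2 * r := by
    have : ‖∫ ξ, ((r : ℂ) / N * ∑ i, ∑ j, Q i j ξ + s ξ ^ 2) ∂P‖ ≤ 2 * z.im⁻¹ ^ 2 * r := by
      refine (norm_integral_le_of_norm_le_const (C := 2 * z.im⁻¹ ^ 2 * r)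
        (ae_of_all _ fun ξ => ?_)).trans (by simp)
      rw [E2, norm_div, norm_neg, norm_pow, Complex.norm_natCast, div_le_iff₀ (by positivity)]
      have h1 := norm_sum_sq_entries_le (G ξ)
      have h2 := norm_sum_sq_diag_le (G ξ)
      rw [Fintype.card_fin] at h1 h2
      have h3 : ‖G ξ‖ ^ 2 ≤ z.im⁻¹ ^ 2 := by gcongr; exact hGn ξ
      calc _ ≤ 2 * (N * ‖G ξ‖ ^ 2) := (norm_sub_le _ _).trans (by linarith)
        _ ≤ 2 * (N * z.im⁻¹ ^ 2) := by gcongr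
        _ = 2 * z.im⁻¹ ^ 2 * (N : ℝ)⁻¹ * N ^ 2 := by field_simp
        _ ≤ _ := by gcongr
    rw [E3, norm_mul, Complex.norm_real, Real.norm_of_nonneg hv]
    calc _ ≤ v * (2 * z.im⁻¹ ^ 2 * r) := by gcongr
      _ = _ := by ring
  have B4 : ‖(v : ℂ) * (∫ ξ, s ξ ^ 2 ∂P - (∫ ξ, s ξ ∂P) ^ 2)‖
      ≤ 16 * z.im⁻¹ ^ 4 * v ^ 2 * r := by
    rw [norm_mul, Complex.norm_real, Real.norm_of_nonneg hv]
    calc _ ≤ v * (16 * z.im⁻¹ ^ 4 * v * (N : ℝ)⁻¹) := by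
          gcongr; exact norm_integral_resolventTrace_sq_sub_le e h hN hz
      _ ≤ v * (16 * z.im⁻¹ ^ 4 * v * r) := by gcongr
      _ = _ := by ring
  -- The four errors: mean of the entries, cumulant expansion, subleading part of the derivative
  -- sum, fluctuation of `s`.
  have key : 1 + z * ∫ ξ, s ξ ∂P + (v : ℂ) * (∫ ξ, s ξ ∂P) ^ 2
      = (r : ℂ) / N * (M * ∫ ξ, ∑ i, ∑ j, G ξ i j ∂P) + (r : ℂ) / N * ∑ i, ∑ j, err i j
        + (v : ℂ) * ((r : ℂ) / N * ∫ ξ, ∑ i, ∑ j, Q i j ξ ∂P + ∫ ξ, s ξ ^ 2 ∂P)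
        - (v : ℂ) * (∫ ξ, s ξ ^ 2 ∂P - (∫ ξ, s ξ ∂P) ^ 2) := by
    rw [E1]; ring
  rw [key]
  refine (norm_sub_le _ _).trans ?_
  refine (add_le_add_left (norm_add₃_le) _).trans ?_
  linarith

end Ensemble

/-! ### A trigonometric integral by sine expansion -/

section TrigonometricIntegral

theorem integral_cos_natCast_mul (n : ℕ) (hn : n ≠ 0) :
    ∫ θ in (0 : ℝ)..Real.pi, Real.cos (n * θ) = 0 := by
  have : (n : ℝ) ≠ 0 := by exact_mod_cast hn
  rw [intervalIntegral.integral_comp_mul_left _ this, integral_cos]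
  simp [Real.sin_nat_mul_pi]

theorem integral_sin_mul_sin_succ (n : ℕ) :
    ∫ θ in (0 : ℝ)..Real.pi, Real.sin θ * Real.sin ((n + 1) * θ)
      = if n = 0 then Real.pi / 2 else 0 := by
  split_ifs with hn
  · subst hn
    have : ∀ θ : ℝ, Real.sin θ * Real.sin (((0 : ℕ) + 1) * θ) = Real.sin θ ^ 2 := fun θ => by
      simp [sq]
    simp only [this, integral_sin_sq]
    simp
  · have h (θ : ℝ) : Real.sin θ * Real.sin ((n + 1) * θ)
        = (Real.cos (n * θ) - Real.cos ((n + 2 : ℕ) * θ)) / 2 := by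
      have h1 : (n : ℝ) * θ = (n + 1) * θ - θ := by ring
      have h2 : ((n + 2 : ℕ) : ℝ) * θ = (n + 1) * θ + θ := by push_cast; ring
      rw [h1, h2, Real.cos_sub, Real.cos_add]
      ring
    simp only [h]
    rw [intervalIntegral.integral_div, intervalIntegral.integral_sub
      (Continuous.intervalIntegrable (by fun_prop) _ _)
      (Continuous.intervalIntegrable (by fun_prop) _ _),
      integral_cos_natCast_mul n hn, integral_cos_natCast_mul (n + 2) (by omega)]
    simp

theorem one_add_two_mul_cos_add_sq (q : ℂ) (θ : ℝ) :
    1 + 2 * q * Real.cos θ + q ^ 2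
      = (1 + q * Complex.exp (θ * Complex.I)) * (1 + q * Complex.exp (-θ * Complex.I)) := by
  have h : Complex.exp (θ * Complex.I) * Complex.exp (-θ * Complex.I) = 1 := by
    rw [← Complex.exp_add]; simp
  have hc : 2 * (Real.cos θ : ℂ) = Complex.exp (θ * Complex.I) + Complex.exp (-θ * Complex.I) := by
    rw [Complex.ofReal_cos, Complex.cos]; ring
  linear_combination q * hc - q ^ 2 * h

theorem one_add_mul_ne_zero {q w : ℂ} (hq : ‖q‖ < 1) (hw : ‖w‖ = 1) : 1 + q * w ≠ 0 := by
  intro h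
  have h1 : q * w = -1 := by linear_combination h
  have := congrArg norm h1
  rw [norm_mul, hw, norm_neg, norm_one] at this
  linarith

theorem norm_exp_neg_ofReal_mul_I (θ : ℝ) : ‖Complex.exp (-θ * Complex.I)‖ = 1 := by
  simpa using Complex.norm_exp_ofReal_mul_I (-θ)

theorem one_add_two_mul_cos_add_sq_ne_zero {q : ℂ} (hq : ‖q‖ < 1) (θ : ℝ) :
    1 + 2 * q * Real.cos θ + q ^ 2 ≠ 0 := by
  rw [one_add_two_mul_cos_add_sq]
  exact mul_ne_zero (one_add_mul_ne_zero hq (Complex.norm_exp_ofReal_mul_I θ))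
    (one_add_mul_ne_zero hq (norm_exp_neg_ofReal_mul_I θ))

/-- The generating function of the sequence `sin ((n + 1) θ)`. -/
theorem hasSum_neg_pow_mul_sin {q : ℂ} (hq : ‖q‖ < 1) (θ : ℝ) :
    HasSum (fun n : ℕ => (-q) ^ n * (Real.sin ((n + 1) * θ) : ℂ))
      (Real.sin θ / (1 + 2 * q * Real.cos θ + q ^ 2)) := by
  have hgeom {w : ℂ} (hw : ‖w‖ = 1) :
      HasSum (fun n : ℕ => (-q) ^ n * w ^ (n + 1)) (w / (1 + q * w)) := by
    have h1 : ‖-(q * w)‖ < 1 := by rwa [norm_neg, norm_mul, hw, mul_one]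
    have h2 := (hasSum_geometric_of_norm_lt_one h1).mul_left w
    have e : (1 - -(q * w)) = 1 + q * w := by ring
    rw [e, ← div_eq_mul_inv] at h2
    refine h2.congr_fun fun n => ?_
    rw [neg_pow (q * w), neg_pow q, mul_pow]
    ring
  have hw := Complex.norm_exp_ofReal_mul_I θ
  have hw' := norm_exp_neg_ofReal_mul_I θ
  have h := ((hgeom hw').sub (hgeom hw)).mul_right (Complex.I / 2)
  have hval : (Real.sin θ : ℂ) / (1 + 2 * q * Real.cos θ + q ^ 2)
      = (Complex.exp (-θ * Complex.I) / (1 + q * Complex.exp (-θ * Complex.I))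
        - Complex.exp (θ * Complex.I) / (1 + q * Complex.exp (θ * Complex.I)))
        * (Complex.I / 2) := by
    rw [one_add_two_mul_cos_add_sq, Complex.ofReal_sin, Complex.sin]
    have h1 := one_add_mul_ne_zero hq hw
    have h2 := one_add_mul_ne_zero hq hw'
    generalize Complex.exp (θ * Complex.I) = a at h1 ⊢
    generalize Complex.exp (-θ * Complex.I) = b at h2 ⊢
    rw [div_sub_div _ _ h2 h1, mul_comm (1 + q * b), div_mul_eq_mul_div]
    congr 1 <;> ring
  rw [hval]
  refine h.congr_fun fun n => ?_
  rw [← Complex.exp_nat_mul, ← Complex.exp_nat_mul, Complex.ofReal_sin, Complex.sin]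
  have e1 : ((n + 1 : ℕ) : ℂ) * (-θ * Complex.I) = -(((n + 1) * θ : ℝ) : ℂ) * Complex.I := by
    push_cast; ring
  have e2 : ((n + 1 : ℕ) : ℂ) * (θ * Complex.I) = (((n + 1) * θ : ℝ) : ℂ) * Complex.I := by
    push_cast; ring
  rw [e1, e2]
  ring

/-- One factor `sin θ` together with the denominator is expanded in the functions `sin ((n + 1) θ)`.
By orthogonality only `n = 0` survives, so the value does not depend on `q`. -/
theorem integral_sin_sq_div {q : ℂ} (hq : ‖q‖ < 1) :
    ∫ θ in (0 : ℝ)..Real.pi, (Real.sin θ : ℂ) ^ 2 / (1 + 2 * q * Real.cos θ + q ^ 2)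
      = (Real.pi : ℂ) / 2 := by
  have h := intervalIntegral.hasSum_integral_of_dominated_convergence (a := 0) (b := Real.pi)
    (μ := volume)
    (F := fun (n : ℕ) (θ : ℝ) => (Real.sin θ : ℂ) * ((-q) ^ n * (Real.sin ((n + 1) * θ) : ℂ)))
    (f := fun θ => (Real.sin θ : ℂ) * (Real.sin θ / (1 + 2 * q * Real.cos θ + q ^ 2)))
    (fun n _ => ‖q‖ ^ n)
    (fun n => Continuous.aestronglyMeasurable (by fun_prop))
    (fun n => ae_of_all _ fun θ _ => by
      rw [norm_mul, norm_mul, norm_pow, norm_neg, Complex.norm_real, Complex.norm_real]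
      have h1 := Real.abs_sin_le_one θ
      have h2 := Real.abs_sin_le_one ((n + 1) * θ)
      rw [Real.norm_eq_abs, Real.norm_eq_abs]
      calc _ ≤ 1 * (‖q‖ ^ n * 1) := by gcongr
        _ = _ := by ring)
    (ae_of_all _ fun θ _ => summable_geometric_of_lt_one (norm_nonneg _) hq)
    (by simp)
    (ae_of_all _ fun θ _ => (hasSum_neg_pow_mul_sin hq θ).mul_left _)
  have e (n : ℕ) : ∫ θ in (0 : ℝ)..Real.pi,
      (Real.sin θ : ℂ) * ((-q) ^ n * (Real.sin ((n + 1) * θ) : ℂ))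
      = if n = 0 then (Real.pi / 2 : ℂ) else 0 := by
    have e1 (θ : ℝ) : (Real.sin θ : ℂ) * ((-q) ^ n * (Real.sin ((n + 1) * θ) : ℂ))
        = (-q) ^ n * ((Real.sin θ * Real.sin ((n + 1) * θ) : ℝ) : ℂ) := by push_cast; ring
    simp only [e1]
    rw [intervalIntegral.integral_const_mul, intervalIntegral.integral_ofReal,
      integral_sin_mul_sin_succ]
    split_ifs with hn
    · subst hn; simp
    · simp
  simp only [e] at h
  have := h.unique (hasSum_ite_eq 0 (Real.pi / 2 : ℂ))
  rw [← this]
  congr 1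
  funext θ
  ring

end TrigonometricIntegral

/-! ### The semicircle law and its Stieltjes transform -/

section Semicircle

theorem integral_semicircle_of_pos {v : ℝ} (hv : 0 < v) {g : ℝ → ℂ} (hg : Continuous g) :
    ∫ x, g x ∂(semicircle v)
      = 2 / Real.pi * ∫ θ in (0 : ℝ)..Real.pi,
          (Real.sin θ : ℂ) ^ 2 * g (-(2 * √v * Real.cos θ)) := by
  have hs : 0 < √v := Real.sqrt_pos.2 hv
  have hs2 : √v ^ 2 = v := Real.sq_sqrt hv.le
  have hdc : Continuous (semicircleDensity v) := by unfold semicircleDensity; fun_prop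
  have hd0 (x) : 0 ≤ semicircleDensity v x := by unfold semicircleDensity; positivity
  rw [semicircle, if_neg hv.ne',
    integral_withDensity_eq_integral_toReal_smul
      (by fun_prop) (ae_of_all _ fun _ => ENNReal.ofReal_lt_top)]
  simp only [ENNReal.toReal_ofReal (hd0 _)]
  have hsupp : ∫ x, semicircleDensity v x • g x
      = ∫ x in (-(2 * √v))..(2 * √v), semicircleDensity v x • g x := by
    rw [intervalIntegral.integral_of_le (by linarith), ← integral_Icc_eq_integral_Ioc]
    refine (setIntegral_eq_integral_of_forall_compl_eq_zero fun x hx => ?_).symm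
    have : 4 * v - x ^ 2 ≤ 0 := by
      by_contra! hlt
      refine hx ⟨?_, ?_⟩ <;> nlinarith
    simp [semicircleDensity, Real.sqrt_eq_zero_of_nonpos this]
  -- Substitution `x = -2 √v cos θ`; the minus sign makes it increase from `-2 √v` to `2 √v` on `[0,
  -- π]`.
  have hsub := intervalIntegral.integral_deriv_smul_comp (a := 0) (b := Real.pi)
    (f := fun θ => -(2 * √v * Real.cos θ)) (f' := fun θ => 2 * √v * Real.sin θ)
    (g := fun x => semicircleDensity v x • g x)
    (fun θ _ => ((Real.hasDerivAt_cos θ).const_mul (2 * √v)).fun_neg.congr_deriv (by ring))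
    (by fun_prop) (by fun_prop)
  simp only [Real.cos_zero, Real.cos_pi, mul_one, mul_neg, neg_neg] at hsub
  rw [hsupp, ← hsub, ← intervalIntegral.integral_const_mul]
  refine intervalIntegral.integral_congr fun θ hθ => ?_
  rw [Set.uIcc_of_le Real.pi_pos.le] at hθ
  have hsin := Real.sin_nonneg_of_mem_Icc hθ
  have hden : semicircleDensity v (-(2 * √v * Real.cos θ)) = Real.sin θ / (Real.pi * √v) := by
    have : 4 * v - (-(2 * √v * Real.cos θ)) ^ 2 = (2 * √v * Real.sin θ) ^ 2 := by
      rw [neg_sq, mul_pow, mul_pow, mul_pow, hs2, Real.cos_sq']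
      rw [mul_pow, hs2]; ring
    rw [semicircleDensity, this, Real.sqrt_sq (by positivity)]
    nth_rewrite 2 [← hs2]
    field_simp
  simp only [Function.comp_apply, hden, Complex.real_smul]
  push_cast
  have h1 : (Real.pi : ℂ) ≠ 0 := by exact_mod_cast Real.pi_ne_zero
  have h2 : ((√v : ℝ) : ℂ) ≠ 0 := by exact_mod_cast hs.ne'
  field_simp

theorem isProbabilityMeasure_semicircle {v : ℝ} (hv : 0 ≤ v) :
    IsProbabilityMeasure (semicircle v) := by
  rcases hv.eq_or_lt with rfl | hv
  · rw [semicircle, if_pos rfl]; infer_instance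
  have h := integral_semicircle_of_pos hv (g := fun _ => 1) continuous_const
  have h2 : ∫ θ in (0 : ℝ)..Real.pi, (Real.sin θ : ℂ) ^ 2 * 1 = (Real.pi : ℂ) / 2 := by
    have e (θ : ℝ) : (Real.sin θ : ℂ) ^ 2 * 1 = ((Real.sin θ ^ 2 : ℝ) : ℂ) := by push_cast; ring
    simp only [e, intervalIntegral.integral_ofReal, integral_sin_sq]
    simp
  have h1 : (Real.pi : ℂ) ≠ 0 := by exact_mod_cast Real.pi_ne_zero
  rw [h2, integral_const] at h
  -- A real mass equal to `1` also excludes infinite mass, whose `toReal` would be `0`.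
  refine ⟨(ENNReal.toReal_eq_one_iff _).1 ?_⟩
  have h3 : 2 / (Real.pi : ℂ) * ((Real.pi : ℂ) / 2) = 1 := by field_simp
  rw [h3] at h
  simpa [Measure.real] using congrArg Complex.re h

/-- The roots of `x² - z x + 1` are mutually inverse. If they had modulus `1` they would be
conjugate and `z` would be real, so one of them lies inside the unit disc. -/
theorem exists_norm_lt_one_add_inv_eq {z : ℂ} (hz : z.im ≠ 0) :
    ∃ q : ℂ, q ≠ 0 ∧ ‖q‖ < 1 ∧ z = q + q⁻¹ := by
  obtain ⟨w, hw⟩ := IsAlgClosed.exists_pow_nat_eq (z ^ 2 - 4) (n := 2) (by norm_num)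
  have hprod : (z + w) / 2 * ((z - w) / 2) = 1 := by linear_combination (-1 / 4 : ℂ) * hw
  have hsum : z = (z + w) / 2 + (z - w) / 2 := by ring
  set a := (z + w) / 2
  set b := (z - w) / 2
  have ha : a ≠ 0 := left_ne_zero_of_mul_eq_one hprod
  have hb : b = a⁻¹ := eq_inv_of_mul_eq_one_right hprod
  rcases lt_trichotomy ‖a‖ 1 with h | h | h
  · exact ⟨a, ha, h, by rw [hsum, hb]⟩
  · exfalso
    refine hz ?_
    rw [hsum, hb, Complex.inv_eq_conj h]
    simp
  · refine ⟨b, hb ▸ inv_ne_zero ha, ?_, by rw [hb, inv_inv, add_comm, ← hb, ← hsum]⟩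
    rw [hb, norm_inv]
    exact inv_lt_one_of_one_lt₀ h

/-- The Stieltjes transform of a measure on the real line. -/
def stieltjes (ν : Measure ℝ) (z : ℂ) : ℂ := ∫ x, ((x : ℂ) - z)⁻¹ ∂ν

theorem ofReal_sub_ne_zero {z : ℂ} (hz : z.im ≠ 0) (x : ℝ) : (x : ℂ) - z ≠ 0 := fun h =>
  hz (by simpa using congrArg Complex.im h)

theorem continuous_inv_ofReal_sub {z : ℂ} (hz : z.im ≠ 0) :
    Continuous fun x : ℝ => ((x : ℂ) - z)⁻¹ :=
  (Complex.continuous_ofReal.sub continuous_const).inv₀ (ofReal_sub_ne_zero hz)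

/-- With `z / √v = q + q⁻¹` and `x = -2 √v cos θ`, the factor `x - z` becomes `-(√v / q)(1 + 2 q cos
θ + q²)`. The transform is therefore `-q / √v`, and the equation is algebra. For `v = 0` it is `-1 /
z`. -/
theorem stieltjes_semicircle {v : ℝ} (hv : 0 ≤ v) {z : ℂ} (hz : z.im ≠ 0) :
    1 + z * stieltjes (semicircle v) z + v * stieltjes (semicircle v) z ^ 2 = 0 := by
  rcases hv.eq_or_lt with rfl | hv
  · have : z ≠ 0 := fun h => hz (by simp [h])
    simp [stieltjes, semicircle, this]
  have hs : 0 < √v := Real.sqrt_pos.2 hv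
  have hsc : ((√v : ℝ) : ℂ) ≠ 0 := by exact_mod_cast hs.ne'
  have hvc : (v : ℂ) = ((√v : ℝ) : ℂ) ^ 2 := by rw [← Complex.ofReal_pow, Real.sq_sqrt hv.le]
  have hz' : (z / (√v : ℝ)).im ≠ 0 := by
    rw [Complex.div_ofReal_im]; exact div_ne_zero hz hs.ne'
  obtain ⟨q, hq0, hq, hzq⟩ := exists_norm_lt_one_add_inv_eq hz'
  have hzq' : z = (√v : ℝ) * (q + q⁻¹) := by rw [← hzq]; field_simp
  have hS : stieltjes (semicircle v) z = -(q / (√v : ℝ)) := by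
    rw [stieltjes, integral_semicircle_of_pos hv (continuous_inv_ofReal_sub hz)]
    have e (θ : ℝ) : (Real.sin θ : ℂ) ^ 2 * (((-(2 * √v * Real.cos θ) : ℝ) : ℂ) - z)⁻¹
        = -(q / (√v : ℝ))
          * ((Real.sin θ : ℂ) ^ 2 / (1 + 2 * q * Real.cos θ + q ^ 2)) := by
      have h1 := one_add_two_mul_cos_add_sq_ne_zero hq θ
      have h2 : ((-(2 * √v * Real.cos θ) : ℝ) : ℂ) - z
          = -((√v : ℝ) / q * (1 + 2 * q * Real.cos θ + q ^ 2)) := by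
        rw [hzq']; push_cast; field_simp; ring
      rw [h2, inv_neg, mul_inv, inv_div]
      ring
    simp only [e]
    rw [intervalIntegral.integral_const_mul, integral_sin_sq_div hq]
    have h1 : (Real.pi : ℂ) ≠ 0 := by exact_mod_cast Real.pi_ne_zero
    field_simp
  rw [hS, hvc, hzq']
  field_simp
  ring

theorem im_inv_ofReal_sub_nonneg {z : ℂ} (hz : 0 < z.im) (x : ℝ) :
    0 ≤ (((x : ℂ) - z)⁻¹).im := by
  rw [Complex.inv_im]
  refine div_nonneg ?_ (Complex.normSq_nonneg _)
  simpa using hz.le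

theorem integrable_inv_ofReal_sub (ν : Measure ℝ) [IsFiniteMeasure ν] {z : ℂ} (hz : 0 < z.im) :
    Integrable (fun x : ℝ => ((x : ℂ) - z)⁻¹) ν :=
  .of_bound (continuous_inv_ofReal_sub hz.ne').aestronglyMeasurable z.im⁻¹
    (ae_of_all _ (norm_inv_ofReal_sub_le hz))

theorem stieltjes_im_nonneg (ν : Measure ℝ) [IsFiniteMeasure ν] {z : ℂ} (hz : 0 < z.im) :
    0 ≤ (stieltjes ν z).im := by
  have h : ∫ x : ℝ, (((x : ℂ) - z)⁻¹).im ∂ν = (stieltjes ν z).im :=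
    integral_im (integrable_inv_ofReal_sub ν hz)
  rw [← h]
  exact integral_nonneg fun x => im_inv_ofReal_sub_nonneg hz x

/-- The quadratic equation of the Stieltjes transform of the semicircle is stable in the upper
half-plane. -/
theorem norm_sub_le_of_quadratic {v : ℝ} (hv : 0 ≤ v) {z m s : ℂ} (hz : 0 < z.im)
    (hm : 1 + z * m + v * m ^ 2 = 0) (hm' : 0 ≤ m.im) (hs' : 0 ≤ s.im) :
    ‖s - m‖ ≤ ‖1 + z * s + v * s ^ 2‖ * z.im⁻¹ := by
  -- Subtracting the exact equation leaves a product with `s - m`. The other factor has imaginary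
  -- part at least `z.im`, since `v`, `s.im` and `m.im` are nonnegative.
  have h1 : 1 + z * s + v * s ^ 2 = (s - m) * (v * (s + m) + z) := by
    linear_combination hm
  have h2 : z.im ≤ ‖v * (s + m) + z‖ := by
    refine le_trans ?_ ((le_abs_self _).trans (Complex.abs_im_le_norm _))
    simp only [Complex.add_im, Complex.im_ofReal_mul]
    nlinarith
  rw [h1, norm_mul, ← div_eq_mul_inv, le_div_iff₀ hz]
  gcongr

end Semicircle
-- The star algebra generated by the functions `x ↦ (x - z)⁻¹`
section ResolventAlgebra

theorem norm_inv_ofReal_sub_le_abs {z : ℂ} (hz : z.im ≠ 0) (x : ℝ) :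
    ‖((x : ℂ) - z)⁻¹‖ ≤ |z.im|⁻¹ := by
  rw [norm_inv]
  refine inv_anti₀ (abs_pos.2 hz) ?_
  simpa using Complex.abs_im_le_norm ((x : ℂ) - z)

/-- The function `x ↦ (x - z)⁻¹` on the real line, for `z` off the real line. -/
def resolventFunction (z : ℂ) (hz : z.im ≠ 0) : ℝ →ᵇ ℂ :=
  BoundedContinuousFunction.ofNormedAddCommGroup (fun x : ℝ => ((x : ℂ) - z)⁻¹)
    (continuous_inv_ofReal_sub hz) |z.im|⁻¹ (norm_inv_ofReal_sub_le_abs hz)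

theorem resolventFunction_apply {z : ℂ} (hz : z.im ≠ 0) (x : ℝ) :
    resolventFunction z hz x = ((x : ℂ) - z)⁻¹ := rfl

/-- The constant function `1` and the functions `x ↦ (x - z)⁻¹`. -/
def resolventGenerators : Set (ℝ →ᵇ ℂ) :=
  insert 1 {f | ∃ (z : ℂ) (hz : z.im ≠ 0), f = resolventFunction z hz}

/-- The linear span of the constant function `1` and the functions `x ↦ (x - z)⁻¹`. -/
def resolventSpan : Submodule ℂ (ℝ →ᵇ ℂ) := Submodule.span ℂ resolventGenerators

theorem resolventFunction_mem {z : ℂ} (hz : z.im ≠ 0) :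
    resolventFunction z hz ∈ resolventSpan :=
  Submodule.subset_span (Or.inr ⟨z, hz, rfl⟩)

theorem one_mem_resolventSpan : (1 : ℝ →ᵇ ℂ) ∈ resolventSpan :=
  Submodule.subset_span (Or.inl rfl)

theorem resolventFunction_sub {z w : ℂ} (hz : z.im ≠ 0) (hw : w.im ≠ 0) :
    resolventFunction z hz - resolventFunction w hw
      = (z - w) • (resolventFunction z hz * resolventFunction w hw) := by
  ext x
  have h1 := ofReal_sub_ne_zero hz x
  have h2 := ofReal_sub_ne_zero hw x
  simp only [BoundedContinuousFunction.coe_sub, Pi.sub_apply, BoundedContinuousFunction.coe_smul,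
    BoundedContinuousFunction.coe_mul, Pi.mul_apply, resolventFunction_apply, smul_eq_mul]
  field_simp
  ring

theorem resolventFunction_mul_mem_of_ne {z w : ℂ} (hz : z.im ≠ 0) (hw : w.im ≠ 0) (hzw : z ≠ w) :
    resolventFunction z hz * resolventFunction w hw ∈ resolventSpan := by
  have h : resolventFunction z hz * resolventFunction w hw
      = (z - w)⁻¹ • (resolventFunction z hz - resolventFunction w hw) := by
    rw [resolventFunction_sub, smul_smul, inv_mul_cancel₀ (sub_ne_zero.2 hzw), one_smul]
  rw [h]
  exact Submodule.smul_mem _ _ (Submodule.sub_mem _ (resolventFunction_mem hz)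
    (resolventFunction_mem hw))

theorem norm_resolventFunction_le {z : ℂ} (hz : z.im ≠ 0) :
    ‖resolventFunction z hz‖ ≤ |z.im|⁻¹ :=
  BoundedContinuousFunction.norm_ofNormedAddCommGroup_le _ (by positivity) _

/-- Partial fractions fail for equal poles, hence the closure. The second pole is moved vertically
away from the real axis by `z.im / (n + 1)`: it stays different from `z`, and the sup-norm bound is
kept as it returns. -/
theorem resolventFunction_mul_self_mem {z : ℂ} (hz : z.im ≠ 0) :
    resolventFunction z hz * resolventFunction z hz ∈ resolventSpan.topologicalClosure := by
  have hw (n : ℕ) : (z + (1 / ((n : ℝ) + 1) * z.im : ℝ) * Complex.I).im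
      = (1 + 1 / ((n : ℝ) + 1)) * z.im := by
    rw [Complex.add_im, Complex.im_ofReal_mul, Complex.I_im]; ring
  have hpos (n : ℕ) : 0 < 1 / ((n : ℝ) + 1) := by positivity
  have hw0 (n : ℕ) : (z + (1 / ((n : ℝ) + 1) * z.im : ℝ) * Complex.I).im ≠ 0 := by
    rw [hw]; exact mul_ne_zero (by linarith [hpos n]) hz
  have habs (n : ℕ) : |(z + (1 / ((n : ℝ) + 1) * z.im : ℝ) * Complex.I).im|⁻¹ ≤ |z.im|⁻¹ := by
    refine inv_anti₀ (abs_pos.2 hz) ?_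
    have h1 : 0 < 1 + 1 / ((n : ℝ) + 1) := by linarith [hpos n]
    rw [hw, abs_mul, abs_of_pos h1]
    exact le_mul_of_one_le_left (abs_nonneg _) (by linarith [hpos n])
  have hlim : Tendsto (fun n : ℕ => resolventFunction _ (hw0 n)) atTop
      (𝓝 (resolventFunction z hz)) := by
    rw [tendsto_iff_norm_sub_tendsto_zero]
    have h0 : Tendsto (fun n : ℕ => 1 / ((n : ℝ) + 1) * (|z.im| * (|z.im|⁻¹ * |z.im|⁻¹))) atTop
        (𝓝 0) := by
      simpa using tendsto_one_div_add_atTop_nhds_zero_nat.mul_const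
        (|z.im| * (|z.im|⁻¹ * |z.im|⁻¹))
    refine squeeze_zero (fun _ => norm_nonneg _) (fun n => ?_) h0
    rw [resolventFunction_sub, norm_smul, add_sub_cancel_left, norm_mul, Complex.norm_I, mul_one,
      Complex.norm_real, Real.norm_eq_abs, abs_mul, abs_of_pos (hpos n), mul_assoc]
    gcongr
    refine (norm_mul_le _ _).trans ?_
    gcongr
    · exact (norm_resolventFunction_le _).trans (habs n)
    · exact norm_resolventFunction_le _
  refine mem_closure_of_tendsto (hlim.const_mul (resolventFunction z hz))
    (Eventually.of_forall fun n => resolventFunction_mul_mem_of_ne hz (hw0 n) fun h => ?_)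
  have h1 := congrArg Complex.im h
  rw [hw] at h1
  have : 1 / ((n : ℝ) + 1) * z.im = 0 := by linarith
  rcases mul_eq_zero.1 this with h2 | h2
  · exact (hpos n).ne' h2
  · exact hz h2

open scoped Pointwise in
theorem resolventSpan_mul_le :
    resolventSpan * resolventSpan ≤ resolventSpan.topologicalClosure := by
  have hle := resolventSpan.le_topologicalClosure
  have hspan : resolventSpan * resolventSpan
      = Submodule.span ℂ (resolventGenerators * resolventGenerators) :=
    Submodule.span_mul_span _ _ _
  rw [hspan, Submodule.span_le]
  rintro _ ⟨f, hf, g, hg, rfl⟩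
  rcases hf with rfl | ⟨z, hz, rfl⟩
  · show 1 * g ∈ _
    rw [one_mul]
    exact hle (Submodule.subset_span hg)
  rcases hg with rfl | ⟨w, hw, rfl⟩
  · show _ * 1 ∈ _
    rw [mul_one]
    exact hle (resolventFunction_mem hz)
  by_cases hzw : z = w
  · subst hzw
    exact resolventFunction_mul_self_mem hz
  · exact hle (resolventFunction_mul_mem_of_ne hz hw hzw)

theorem star_resolventFunction {z : ℂ} (hz : z.im ≠ 0) :
    star (resolventFunction z hz)
      = resolventFunction (starRingEnd ℂ z) (by simpa using hz) := by
  ext x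
  simp [resolventFunction_apply]

theorem star_mem_resolventSpan {f : ℝ →ᵇ ℂ} (hf : f ∈ resolventSpan) :
    star f ∈ resolventSpan := by
  induction hf using Submodule.span_induction with
  | mem f hf =>
    rcases hf with rfl | ⟨z, hz, rfl⟩
    · simpa using one_mem_resolventSpan
    · rw [star_resolventFunction]
      exact resolventFunction_mem _
  | zero => simp
  | add f g _ _ hf hg => rw [star_add]; exact add_mem hf hg
  | smul c f _ hf => rw [star_smul]; exact Submodule.smul_mem _ _ hf

/-- The closed star subalgebra generated by the functions `x ↦ (x - z)⁻¹`. -/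
def resolventAlgebra : StarSubalgebra ℂ (ℝ →ᵇ ℂ) where
  carrier := resolventSpan.topologicalClosure
  mul_mem' {f g} hf hg := by
    have h : f * g ∈ closure (resolventSpan.topologicalClosure : Set (ℝ →ᵇ ℂ)) :=
      map_mem_closure₂ continuous_mul hf hg fun a ha b hb =>
        resolventSpan_mul_le (Submodule.mul_mem_mul ha hb)
    rwa [resolventSpan.isClosed_topologicalClosure.closure_eq] at h
  add_mem' hf hg := add_mem hf hg
  algebraMap_mem' c := by
    rw [Algebra.algebraMap_eq_smul_one]
    exact Submodule.smul_mem _ _ (resolventSpan.le_topologicalClosure one_mem_resolventSpan)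
  star_mem' {f} hf := map_mem_closure continuous_star hf fun _ hg => star_mem_resolventSpan hg

theorem separatesPoints_resolventAlgebra :
    (resolventAlgebra.map (BoundedContinuousFunction.toContinuousMapStarₐ ℂ)).SeparatesPoints := by
  intro x y hxy
  have hI : Complex.I.im ≠ 0 := by simp
  refine ⟨_, ⟨_, ⟨resolventFunction Complex.I hI,
    resolventSpan.le_topologicalClosure (resolventFunction_mem hI), rfl⟩, rfl⟩, ?_⟩
  simpa [resolventFunction_apply] using hxy

end ResolventAlgebra

/-! ### From Stieltjes transforms to weak convergence -/

section Convergence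

/-- Integration against a probability measure is a contraction in the sup norm, uniformly in `n`, so
an `ε / 3` argument applies. -/
theorem isClosed_setOf_tendsto_integral (μ : ℕ → ProbabilityMeasure ℝ) (μ₀ : ProbabilityMeasure ℝ) :
    IsClosed {g : ℝ →ᵇ ℂ | Tendsto (fun n => ∫ x, g x ∂(μ n : Measure ℝ)) atTop
      (𝓝 (∫ x, g x ∂(μ₀ : Measure ℝ)))} := by
  have hdist (ν : ProbabilityMeasure ℝ) (f g : ℝ →ᵇ ℂ) :
      dist (∫ x, f x ∂(ν : Measure ℝ)) (∫ x, g x ∂(ν : Measure ℝ)) ≤ dist f g := by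
    rw [dist_eq_norm, ← integral_sub (f.integrable _) (g.integrable _)]
    refine (norm_integral_le_of_norm_le_const (C := dist f g) (ae_of_all _ fun x => ?_)).trans
      (by simp)
    rw [← dist_eq_norm]
    exact BoundedContinuousFunction.dist_coe_le_dist x
  refine isClosed_of_closure_subset fun g hg => ?_
  rw [Set.mem_ofPred_eq, Metric.tendsto_atTop]
  intro ε hε
  obtain ⟨f, hf, hfg⟩ := Metric.mem_closure_iff.1 hg (ε / 3) (by positivity)
  obtain ⟨K, hK⟩ := Metric.tendsto_atTop.1 hf (ε / 3) (by positivity)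
  refine ⟨K, fun n hn => ?_⟩
  have h1 := hdist (μ n) g f
  have h2 := hdist μ₀ f g
  rw [dist_comm f g] at h2
  have h3 := hK n hn
  have h4 := dist_triangle4 (∫ x, g x ∂(μ n : Measure ℝ)) (∫ x, f x ∂(μ n : Measure ℝ))
    (∫ x, f x ∂(μ₀ : Measure ℝ)) (∫ x, g x ∂(μ₀ : Measure ℝ))
  linarith

theorem stieltjes_conj (ν : Measure ℝ) (z : ℂ) :
    stieltjes ν (starRingEnd ℂ z) = starRingEnd ℂ (stieltjes ν z) := by
  rw [stieltjes, stieltjes, ← integral_conj]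
  simp

theorem tendsto_integral_of_mem_resolventAlgebra {μ : ℕ → ProbabilityMeasure ℝ}
    {μ₀ : ProbabilityMeasure ℝ}
    (h : ∀ z : ℂ, 0 < z.im → Tendsto (fun n => stieltjes (μ n) z) atTop (𝓝 (stieltjes μ₀ z)))
    {g : ℝ →ᵇ ℂ} (hg : g ∈ resolventAlgebra) :
    Tendsto (fun n => ∫ x, g x ∂(μ n : Measure ℝ)) atTop (𝓝 (∫ x, g x ∂(μ₀ : Measure ℝ))) := by
  refine closure_minimal (fun f hf => ?_) (isClosed_setOf_tendsto_integral μ μ₀) hg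
  rw [Set.mem_ofPred_eq]
  induction hf using Submodule.span_induction with
  | mem f hf =>
    rcases hf with rfl | ⟨z, hz, rfl⟩
    · simp
    · simp only [resolventFunction_apply]
      rcases hz.lt_or_gt with hz | hz
      -- Poles in the lower half-plane are handled by conjugation.
      · have h1 := h (starRingEnd ℂ z) (by simpa using hz)
        simp only [stieltjes_conj] at h1
        simpa [Function.comp_def, stieltjes] using (Complex.continuous_conj.tendsto _).comp h1
      · exact h z hz
  | zero => simp
  | add f g _ _ hf hg =>
    simp only [BoundedContinuousFunction.coe_add, Pi.add_apply]
    simp only [integral_add (f.integrable _) (g.integrable _)]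
    exact hf.add hg
  | smul c f _ hf =>
    simp only [BoundedContinuousFunction.coe_smul]
    simp only [integral_smul]
    exact hf.const_smul c

theorem im_inv_ofReal_sub_mul_I (x r : ℝ) :
    (((x : ℂ) - r * Complex.I)⁻¹).im = r / (x ^ 2 + r ^ 2) := by
  rw [Complex.inv_im, Complex.normSq_apply]
  simp
  ring

theorem one_sub_mul_stieltjes_im_eq (ν : Measure ℝ) [IsProbabilityMeasure ν] {r : ℝ}
    (hr : 0 < r) :
    1 - r * (stieltjes ν (r * Complex.I)).im = ∫ x, x ^ 2 / (x ^ 2 + r ^ 2) ∂ν := by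
  have hz : 0 < ((r : ℂ) * Complex.I).im := by simpa using hr
  have hint := integrable_inv_ofReal_sub ν hz
  have him : (stieltjes ν (r * Complex.I)).im = ∫ x, r / (x ^ 2 + r ^ 2) ∂ν := by
    have h := integral_im hint
    rw [stieltjes]
    refine h.symm.trans (integral_congr_ae (ae_of_all _ fun x => im_inv_ofReal_sub_mul_I x r))
  have hint' : Integrable (fun x : ℝ => r / (x ^ 2 + r ^ 2)) ν :=
    hint.im.congr (ae_of_all _ fun x => im_inv_ofReal_sub_mul_I x r)
  have e (x : ℝ) : x ^ 2 / (x ^ 2 + r ^ 2) = 1 - r * (r / (x ^ 2 + r ^ 2)) := by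
    have : x ^ 2 + r ^ 2 ≠ 0 := by positivity
    field_simp
    ring
  simp only [e]
  rw [integral_sub (integrable_const _) (hint'.const_mul r), integral_const_mul, him]
  simp

/-- The right side is twice the integral of `x² / (x² + r²)`, which is at least `1 / 2` where `|x| >
r`. Tails are thus controlled by a single value of the Stieltjes transform. -/
theorem measure_norm_gt_le_stieltjes (ν : Measure ℝ) [IsProbabilityMeasure ν] {r : ℝ}
    (hr : 0 < r) :
    ν {x | r < ‖x‖} ≤ ENNReal.ofReal (2 * (1 - r * (stieltjes ν (r * Complex.I)).im)) := by
  have hint : Integrable (fun x : ℝ => x ^ 2 / (x ^ 2 + r ^ 2)) ν := by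
    refine .of_bound (C := 1) (Measurable.aestronglyMeasurable (by fun_prop)) (ae_of_all _ fun x => ?_)
    rw [Real.norm_of_nonneg (by positivity)]
    exact div_le_one_of_le₀ (by nlinarith [sq_nonneg r]) (by positivity)
  have hmarkov := mul_meas_ge_le_integral_of_nonneg
    (ae_of_all ν fun x : ℝ => (by positivity : 0 ≤ x ^ 2 / (x ^ 2 + r ^ 2))) hint (1 / 2)
  rw [one_sub_mul_stieltjes_im_eq ν hr]
  have hsub : {x : ℝ | r < ‖x‖} ⊆ {x | 1 / 2 ≤ x ^ 2 / (x ^ 2 + r ^ 2)} := by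
    intro x hx
    have hx' : r < |x| := hx
    have : r ^ 2 ≤ x ^ 2 := by rw [← sq_abs x]; gcongr
    rw [Set.mem_ofPred_eq, le_div_iff₀ (by positivity)]
    linarith
  calc ν {x | r < ‖x‖} = ENNReal.ofReal (ν.real {x | r < ‖x‖}) := by simp
    _ ≤ ENNReal.ofReal (ν.real {x | 1 / 2 ≤ x ^ 2 / (x ^ 2 + r ^ 2)}) := by gcongr; simp
    _ ≤ _ := by gcongr; linarith

theorem tendsto_one_sub_mul_stieltjes_im (ν : Measure ℝ) [IsProbabilityMeasure ν] :
    Tendsto (fun r : ℝ => 2 * (1 - r * (stieltjes ν (r * Complex.I)).im)) atTop (𝓝 0) := by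
  have h : Tendsto (fun r : ℝ => ∫ x, x ^ 2 / (x ^ 2 + r ^ 2) ∂ν) atTop (𝓝 (∫ _, 0 ∂ν)) := by
    refine tendsto_integral_filter_of_dominated_convergence (fun _ => 1)
      (Eventually.of_forall fun r => Measurable.aestronglyMeasurable (by fun_prop))
      (Eventually.of_forall fun r => ae_of_all _ fun x => ?_) (integrable_const _)
      (ae_of_all _ fun x => ?_)
    · rw [Real.norm_of_nonneg (by positivity)]
      exact div_le_one_of_le₀ (by nlinarith [sq_nonneg r]) (by positivity)
    · exact Tendsto.div_atTop tendsto_const_nhds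
        (tendsto_atTop_add_const_left _ _ (tendsto_pow_atTop two_ne_zero))
  rw [integral_zero] at h
  have h2 := h.const_mul 2
  rw [mul_zero] at h2
  refine h2.congr' ?_
  filter_upwards [eventually_gt_atTop 0] with r hr
  rw [one_sub_mul_stieltjes_im_eq ν hr]

theorem isTightMeasureSet_of_tendsto_stieltjes {μ : ℕ → ProbabilityMeasure ℝ}
    {μ₀ : ProbabilityMeasure ℝ}
    (h : ∀ z : ℂ, 0 < z.im → Tendsto (fun n => stieltjes (μ n) z) atTop (𝓝 (stieltjes μ₀ z))) :
    IsTightMeasureSet (Set.range fun n => (μ n : Measure ℝ)) := by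
  refine isTightMeasureSet_range_of_tendsto_limsup_measure_norm_gt ?_
  have h0 := ENNReal.tendsto_ofReal (tendsto_one_sub_mul_stieltjes_im (μ₀ : Measure ℝ))
  rw [ENNReal.ofReal_zero] at h0
  refine tendsto_of_tendsto_of_tendsto_of_le_of_le' tendsto_const_nhds h0
    (Eventually.of_forall fun _ => zero_le) ?_
  filter_upwards [eventually_gt_atTop 0] with r hr
  have hz : 0 < ((r : ℂ) * Complex.I).im := by simpa using hr
  -- For fixed `r` the tail bounds of the `μ n` converge to the one of `μ₀`, which bounds the limsup
  -- and tends to `0` as `r → ∞`.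
  have h1 := ENNReal.tendsto_ofReal
    ((((Complex.continuous_im.tendsto _).comp (h _ hz)).const_mul r).const_sub 1 |>.const_mul 2)
  rw [← h1.limsup_eq]
  exact limsup_le_limsup (Eventually.of_forall fun n => measure_norm_gt_le_stieltjes _ hr)

/-- Pointwise convergence of Stieltjes transforms to the Stieltjes transform of a probability
measure implies weak convergence. -/
theorem tendsto_of_tendsto_stieltjes {μ : ℕ → ProbabilityMeasure ℝ} {μ₀ : ProbabilityMeasure ℝ}
    (h : ∀ z : ℂ, 0 < z.im → Tendsto (fun n => stieltjes (μ n) z) atTop (𝓝 (stieltjes μ₀ z))) :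
    Tendsto μ atTop (𝓝 μ₀) :=
  ProbabilityMeasure.tendsto_of_tight_of_separatesPoints ℂ
    (isTightMeasureSet_of_tendsto_stieltjes h) separatesPoints_resolventAlgebra
    fun _ hg => tendsto_integral_of_mem_resolventAlgebra h hg

end Convergence
-- Measurability of the spectral measure
section SpectralMeasure

variable {N : ℕ}

theorem integral_eigenvalueDistribution {E : Type*} [NormedAddCommGroup E] [NormedSpace ℝ E]
    [CompleteSpace E] (M : Matrix (Fin N) (Fin N) ℝ) (hM : M.IsHermitian) (f : ℝ → E) :
    ∫ x, f x ∂(eigenvalueDistribution M hM) = (N : ℝ)⁻¹ • ∑ j, f (hM.eigenvalues j) := by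
  rw [eigenvalueDistribution, integral_smul_measure,
    integral_finsetSum_measure fun j _ => integrable_dirac (by simp)]
  simp

theorem isProbabilityMeasure_eigenvalueDistribution (hN : 0 < N) (M : Matrix (Fin N) (Fin N) ℝ)
    (hM : M.IsHermitian) : IsProbabilityMeasure (eigenvalueDistribution M hM) := by
  refine ⟨?_⟩
  simp only [eigenvalueDistribution, Measure.smul_apply, Measure.finsetSum_apply, measure_univ,
    smul_eq_mul]
  simp only [Finset.sum_const, Finset.card_univ, Fintype.card_fin, nsmul_eq_mul, mul_one]
  exact ENNReal.inv_mul_cancel (by exact_mod_cast hN.ne') (ENNReal.natCast_ne_top N)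

theorem trace_pow_eq_sum_eigenvalues_pow {n : Type*} [Fintype n] [DecidableEq n]
    {M : Matrix n n ℝ} (hM : M.IsHermitian) (k : ℕ) :
    (M ^ k).trace = ∑ j, hM.eigenvalues j ^ k := by
  conv_lhs => rw [hM.spectral_theorem, ← map_pow, Matrix.diagonal_pow,
    Unitary.conjStarAlgAut_apply, Matrix.trace_mul_comm, ← Matrix.mul_assoc,
    Unitary.coe_star_mul_self, Matrix.one_mul, Matrix.trace_diagonal]
  simp

variable (e : Sym2 (Fin N) ↪ ℕ)

theorem continuous_normalizedMatrix : Continuous (normalizedMatrix e) := by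
  have h : Continuous (ensembleMatrix e) := continuous_matrix fun i j => continuous_apply _
  exact h.const_smul ((√(N : ℝ))⁻¹)

theorem continuous_sum_eval_eigenvalues (p : Polynomial ℝ) :
    Continuous fun ξ => ∑ j, p.eval ((normalizedMatrix_isHermitian e ξ).eigenvalues j) := by
  have h (ξ : ℕ → ℝ) : ∑ j, p.eval ((normalizedMatrix_isHermitian e ξ).eigenvalues j)
      = ∑ k ∈ Finset.range (p.natDegree + 1), p.coeff k * (normalizedMatrix e ξ ^ k).trace := by
    simp only [Polynomial.eval_eq_sum_range, trace_pow_eq_sum_eigenvalues_pow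
      (normalizedMatrix_isHermitian e ξ), Finset.mul_sum]
    exact Finset.sum_comm
  simp only [h]
  exact continuous_finsetSum _ fun k _ => continuous_const.mul
    (((continuous_normalizedMatrix e).pow k).matrix_trace)

/-- Linear statistics of the eigenvalues with continuous test function are measurable. -/
theorem measurable_sum_eigenvalues {f : ℝ → ℝ} (hf : Continuous f) :
    Measurable fun ξ => ∑ j, f ((normalizedMatrix_isHermitian e ξ).eigenvalues j) := by
  -- Measurability of single eigenvalues is avoided: polynomial statistics are traces of powers,
  -- hence continuous. Weierstrass approximation on `[-n, n]` suffices, since for fixed `ξ` this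
  -- interval eventually contains all eigenvalues.
  have hp (n : ℕ) : ∃ p : Polynomial ℝ, ∀ x ∈ Set.Icc (-(n : ℝ)) n,
      |p.eval x - f x| < 1 / ((n : ℝ) + 1) :=
    exists_polynomial_near_of_continuousOn _ _ f hf.continuousOn _ (by positivity)
  choose p hp using hp
  refine measurable_of_tendsto_metrizable
    (fun n => (continuous_sum_eval_eigenvalues e (p n)).measurable) ?_
  refine tendsto_pi_nhds.2 fun ξ => tendsto_finsetSum _ fun j _ => ?_
  set x := (normalizedMatrix_isHermitian e ξ).eigenvalues j
  rw [tendsto_iff_norm_sub_tendsto_zero]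
  refine squeeze_zero' (Eventually.of_forall fun _ => norm_nonneg _) ?_
    tendsto_one_div_add_atTop_nhds_zero_nat
  obtain ⟨n₀, hn₀⟩ := exists_nat_ge |x|
  filter_upwards [eventually_ge_atTop n₀] with n hn
  have hn' : (n₀ : ℝ) ≤ n := by exact_mod_cast hn
  exact (hp n x (Set.mem_Icc.2 (abs_le.1 (hn₀.trans hn')))).le

theorem measurable_integral_spectralMeasure {f : ℝ → ℝ} (hf : Continuous f) :
    Measurable fun ξ => ∫ x, f x ∂(spectralMeasure e ξ) := by
  simp only [spectralMeasure, integral_eigenvalueDistribution, smul_eq_mul]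
  exact (measurable_sum_eigenvalues e hf).const_mul _

theorem isProbabilityMeasure_spectralMeasure (hN : 0 < N) (ξ : ℕ → ℝ) :
    IsProbabilityMeasure (spectralMeasure e ξ) :=
  isProbabilityMeasure_eigenvalueDistribution hN _ _

/-- Closed sets form a generating π-system, and their indicators are limits of bounded continuous
functions, whose integrals are already known to be measurable. -/
theorem measurable_spectralMeasure (hN : 0 < N) : Measurable (spectralMeasure e) := by
  have := isProbabilityMeasure_spectralMeasure e hN
  refine Measurable.measure_of_isPiSystem_of_isProbabilityMeasure
    (borel_eq_generateFrom_isClosed (α := ℝ) ▸ BorelSpace.measurable_eq) isPiSystem_isClosed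
    fun F hF => ?_
  refine measurable_of_tendsto_metrizable (f := fun n ξ => ∫⁻ x, hF.apprSeq n x
    ∂(spectralMeasure e ξ)) (fun n => ?_)
    (tendsto_pi_nhds.2 fun ξ => HasOuterApproxClosed.tendsto_lintegral_apprSeq hF _)
  have hc : Continuous fun x => (hF.apprSeq n x : ℝ) :=
    NNReal.continuous_coe.comp (hF.apprSeq n).continuous
  have h (ξ : ℕ → ℝ) : ∫⁻ x, hF.apprSeq n x ∂(spectralMeasure e ξ)
      = ENNReal.ofReal (∫ x, (hF.apprSeq n x : ℝ) ∂(spectralMeasure e ξ)) := by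
    rw [ofReal_integral_eq_lintegral_ofReal]
    · simp
    · refine .of_bound hc.aestronglyMeasurable 1 (ae_of_all _ fun x => ?_)
      simpa using HasOuterApproxClosed.apprSeq_apply_le_one hF n x
    · exact ae_of_all _ fun _ => NNReal.coe_nonneg _
  simp only [h]
  exact (measurable_integral_spectralMeasure e hc).ennreal_ofReal

theorem stieltjes_spectralMeasure {z : ℂ} (hz : 0 < z.im) (ξ : ℕ → ℝ) :
    stieltjes (spectralMeasure e ξ) z = resolventTrace e z ξ := by
  rw [stieltjes, spectralMeasure, integral_eigenvalueDistribution, resolventTrace,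
    trace_resolventMatrix (normalizedMatrix_isHermitian e ξ) hz, Complex.real_smul]
  push_cast
  rw [div_eq_inv_mul]

theorem norm_integral_spectralMeasure_le (f : ℝ →ᵇ ℝ) (ξ : ℕ → ℝ) :
    ‖∫ x, f x ∂(spectralMeasure e ξ)‖ ≤ ‖f‖ := by
  rcases Nat.eq_zero_or_pos N with rfl | hN
  · simp [spectralMeasure, integral_eigenvalueDistribution]
  · have := isProbabilityMeasure_spectralMeasure e hN ξ
    exact f.norm_integral_le_norm _

end SpectralMeasure

/-! ### Averaged measures, the i.i.d. semicircle law and the mixture -/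

section Mixture

theorem integral_bind {α β : Type*} [MeasurableSpace α] [MeasurableSpace β] {μ : Measure α}
    {κ : α → Measure β} (hκ : Measurable κ) {E : Type*} [NormedAddCommGroup E] [NormedSpace ℝ E]
    {f : β → E} (hf : Integrable f (μ.bind κ)) :
    ∫ y, f y ∂(μ.bind κ) = ∫ x, ∫ y, f y ∂(κ x) ∂μ := by
  set K : Kernel α β := ⟨κ, hκ⟩
  have h : μ.bind κ = (K ∘ₖ Kernel.const Unit μ) () := Measure.comp_eq_comp_const_apply (κ := K)
  rw [h] at hf ⊢
  exact Kernel.integral_comp hf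

theorem isProbabilityMeasure_bind {α β : Type*} [MeasurableSpace α] [MeasurableSpace β]
    {μ : Measure α} [IsProbabilityMeasure μ] {κ : α → Measure β} (hκ : Measurable κ)
    (h : ∀ x, IsProbabilityMeasure (κ x)) : IsProbabilityMeasure (μ.bind κ) := by
  refine ⟨?_⟩
  rw [Measure.bind_apply .univ hκ.aemeasurable]
  simp

theorem measurable_integral_of_measurable {α β : Type*} [MeasurableSpace α] [MeasurableSpace β]
    {κ : α → Measure β} (hκ : Measurable κ) {f : β → ℝ} (hf : Measurable f) :
    Measurable fun x => ∫ y, f y ∂(κ x) :=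
  (hf.stronglyMeasurable.integral_kernel (κ := (⟨κ, hκ⟩ : Kernel α β))).measurable

variable {ν : Measure ℝ} [IsProbabilityMeasure ν]

theorem isProbabilityMeasure_iidLaw : IsProbabilityMeasure (iidLaw ν) := by
  unfold iidLaw; infer_instance

/-- The semicircle law in expectation for i.i.d. entries, in terms of Stieltjes transforms. -/
theorem tendsto_integral_resolventTrace (h : AllMomentsExist ν)
    (e : ∀ N : ℕ, Sym2 (Fin N) ↪ ℕ) {z : ℂ} (hz : 0 < z.im) :
    Tendsto (fun N => ∫ ξ, resolventTrace (e N) z ξ ∂(iidLaw ν)) atTop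
      (𝓝 (stieltjes (semicircle (variance (fun x => x) ν)) z)) := by
  have := isProbabilityMeasure_iidLaw (ν := ν)
  have hv : 0 ≤ variance (fun x => x) ν := variance_nonneg _ _
  have := isProbabilityMeasure_semicircle hv
  have hlim : Tendsto (fun N : ℕ => (√(N : ℝ))⁻¹) atTop (𝓝 0) :=
    tendsto_inv_atTop_zero.comp (Real.tendsto_sqrt_atTop.comp tendsto_natCast_atTop_atTop)
  rw [tendsto_iff_norm_sub_tendsto_zero]
  set C := |∫ y, y ∂ν| * z.im⁻¹ + 2 * z.im⁻¹ ^ 3 * cumulantError ν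
          + 2 * variance (fun x => x) ν * z.im⁻¹ ^ 2
          + 16 * z.im⁻¹ ^ 4 * variance (fun x => x) ν ^ 2 with hC
  have hlim' : Tendsto (fun N : ℕ => C * (√(N : ℝ))⁻¹ * z.im⁻¹) atTop (𝓝 0) := by
    simpa using (hlim.const_mul C).mul_const z.im⁻¹
  refine squeeze_zero' (Eventually.of_forall fun _ => norm_nonneg _) ?_ hlim'
  filter_upwards [eventually_gt_atTop 0] with N hN
  have hint : Integrable (resolventTrace (e N) z) (iidLaw ν) :=
    .of_bound (measurable_resolventTrace _ z).aestronglyMeasurable z.im⁻¹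
      (ae_of_all _ (norm_resolventTrace_le (e N) hz))
  -- Stability of the quadratic equation needs the expected trace to have nonnegative imaginary
  -- part; it is an average of Stieltjes transforms.
  have him : 0 ≤ (∫ ξ, resolventTrace (e N) z ξ ∂(iidLaw ν)).im := by
    have h1 : ∫ ξ, (resolventTrace (e N) z ξ).im ∂(iidLaw ν)
        = (∫ ξ, resolventTrace (e N) z ξ ∂(iidLaw ν)).im := integral_im hint
    rw [← h1]
    refine integral_nonneg fun ξ => ?_
    have := isProbabilityMeasure_spectralMeasure (e N) hN ξ
    simp only [Pi.zero_apply]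
    rw [← stieltjes_spectralMeasure (e N) hz]
    exact stieltjes_im_nonneg _ hz
  refine (norm_sub_le_of_quadratic hv hz (stieltjes_semicircle hv hz.ne')
    (stieltjes_im_nonneg _ hz) him).trans ?_
  gcongr
  exact norm_self_consistent_le (e N) h hN hz

/-- The semicircle law in expectation for i.i.d. entries. -/
theorem tendsto_integral_integral_spectralMeasure (h : AllMomentsExist ν)
    (e : ∀ N : ℕ, Sym2 (Fin N) ↪ ℕ) (f : ℝ →ᵇ ℝ) :
    Tendsto (fun N => ∫ ξ, (∫ x, f x ∂(spectralMeasure (e N) ξ)) ∂(iidLaw ν)) atTop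
      (𝓝 (∫ x, f x ∂(semicircle (variance (fun x => x) ν)))) := by
  have := isProbabilityMeasure_iidLaw (ν := ν)
  have hv : 0 ≤ variance (fun x => x) ν := variance_nonneg _ _
  have hprob (N : ℕ) := isProbabilityMeasure_bind (μ := iidLaw ν)
    (measurable_spectralMeasure (e (N + 1)) N.succ_pos)
    (isProbabilityMeasure_spectralMeasure (e (N + 1)) N.succ_pos)
  -- The index is shifted because for `N = 0` the spectral measure is zero. The Stieltjes transform
  -- of the averaged measure is the expected resolvent trace.
  let ρ (N : ℕ) : ProbabilityMeasure ℝ :=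
    ⟨(iidLaw ν).bind (spectralMeasure (e (N + 1))), hprob N⟩
  let ρ₀ : ProbabilityMeasure ℝ :=
    ⟨semicircle (variance (fun x => x) ν), isProbabilityMeasure_semicircle hv⟩
  have hconv : Tendsto ρ atTop (𝓝 ρ₀) := by
    refine tendsto_of_tendsto_stieltjes fun z hz => ?_
    refine ((tendsto_integral_resolventTrace h e hz).comp (tendsto_add_atTop_nat 1)).congr
      fun N => ?_
    have := hprob N
    have h1 := integral_bind (measurable_spectralMeasure (e (N + 1)) N.succ_pos)
      (integrable_inv_ofReal_sub ((iidLaw ν).bind (spectralMeasure (e (N + 1)))) hz)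
    refine Eq.trans ?_ h1.symm
    exact integral_congr_ae (ae_of_all _ fun ξ => (stieltjes_spectralMeasure _ hz ξ).symm)
  rw [ProbabilityMeasure.tendsto_iff_forall_integral_tendsto] at hconv
  refine (tendsto_add_atTop_iff_nat 1).1 ((hconv f).congr fun N => ?_)
  have := hprob N
  exact integral_bind (measurable_spectralMeasure (e (N + 1)) N.succ_pos) (f.integrable _)

end Mixture

end ExchangeableEnsemble

open ExchangeableEnsemble in
theorem theorem8p2 {T : Type*} [MeasurableSpace T]
    (μ : Measure T) [IsProbabilityMeasure μ]
    (Λ : Kernel T ℝ) [IsMarkovKernel Λ]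
    (hΛ : ∀ τ, ExchangeableEnsemble.AllMomentsExist (Λ τ))
    (e : ∀ N : ℕ, Sym2 (Fin N) ↪ ℕ) :
    IsProbabilityMeasure (ExchangeableEnsemble.semicircleMixture μ Λ) ∧
    ExchangeableEnsemble.ConvergesWeaklyInExpectation
      (ExchangeableEnsemble.exchangeableLaw μ Λ)
      (fun N ξ => ExchangeableEnsemble.spectralMeasure (e N) ξ)
      (fun _ => ExchangeableEnsemble.semicircleMixture μ Λ) := by
  have hmP := measurable_iidLaw Λ
  have hmS : Measurable fun τ => semicircle (entryVariance Λ τ) :=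
    measurable_semicircle.comp (measurable_entryVariance Λ)
  have hP : IsProbabilityMeasure (exchangeableLaw μ Λ) :=
    isProbabilityMeasure_bind hmP fun _ => isProbabilityMeasure_iidLaw
  have hSτ (τ : T) : IsProbabilityMeasure (semicircle (entryVariance Λ τ)) :=
    isProbabilityMeasure_semicircle (variance_nonneg _ _)
  have hS : IsProbabilityMeasure (semicircleMixture μ Λ) := isProbabilityMeasure_bind hmS hSτ
  refine ⟨hS, fun f => ?_⟩
  have hm (N : ℕ) := measurable_integral_spectralMeasure (e N) f.continuous
  have hint (N : ℕ) : Integrable (fun ξ => ∫ x, f x ∂(spectralMeasure (e N) ξ))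
      (exchangeableLaw μ Λ) :=
    .of_bound (hm N).aestronglyMeasurable ‖f‖
      (ae_of_all _ (norm_integral_spectralMeasure_le (e N) f))
  refine ⟨hint, integrable_const _, ?_⟩
  have h1 (N : ℕ) : ∫ ξ, (∫ x, f x ∂(spectralMeasure (e N) ξ)) ∂(exchangeableLaw μ Λ)
      = ∫ τ, ∫ ξ, (∫ x, f x ∂(spectralMeasure (e N) ξ)) ∂(iidLaw (Λ τ)) ∂μ :=
    integral_bind hmP (hint N)
  have h2 : ∫ _, (∫ x, f x ∂(semicircleMixture μ Λ)) ∂(exchangeableLaw μ Λ)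
      = ∫ τ, ∫ x, f x ∂(semicircle (entryVariance Λ τ)) ∂μ := by
    rw [integral_const, probReal_univ, one_smul]
    exact integral_bind hmS (f.integrable (semicircleMixture μ Λ))
  simp only [h1, h2]
  -- The rate of convergence depends on `τ` through the moments of `Λ τ`, but pointwise convergence
  -- in `τ` with the constant bound `‖f‖` is enough.
  refine tendsto_integral_of_dominated_convergence (fun _ => ‖f‖)
    (fun N => (measurable_integral_of_measurable hmP (hm N)).aestronglyMeasurable)
    (integrable_const _) (fun N => ae_of_all _ fun τ => ?_)
    (ae_of_all _ fun τ => tendsto_integral_integral_spectralMeasure (hΛ τ) e f)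
  have := isProbabilityMeasure_iidLaw (ν := Λ τ)
  exact (norm_integral_le_of_norm_le_const
    (ae_of_all _ (norm_integral_spectralMeasure_le (e N) f))).trans (by simp)

end
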